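/- Let $\nu\in C^2(\mathbb R)$ be $1$-periodic with $\nu\ge\kappa>0$ on $(0,1)$, let $f_1\in C^\infty(\mathbb R)$ be $1$-periodic, let $k\in\{0,1,2,\dots\}$, and for $0<\varepsilon\le 1$ let $D_\varepsilon=(0,1)\times(-\varepsilon/2,\varepsilon/2)$. Write $(\mathcal D u)_{ij}=\frac12(\partial_j u_i+\partial_i u_j)$ and $e_1=(1,0)$. Exact problem. Let $H^1_{per,1,0}(D_\varepsilon)$ be the completion in the $H^1(D_\varepsilon)$-norm of the $C^\infty(\mathbb R\times[-\frac\varepsilon2,\frac\varepsilon2])$ functions that are $1$-periodic in $x_1$ and vanish for $x_2=\pm\varepsilon/2$, and let $H_{per}(D_\varepsilon)=\{u\in (H^1_{per,1,0}(D_\varepsilon))^2:\operatorname{div}u=0\}$. A weak solution of the periodic Stokes problem $$-\operatorname{div}(\nu(x_1)\mathcal D u)+\nabla p=f_1(x_1)e_1,\qquad \operatorname{div}u=0\quad\text{in }D_\varepsilon,\qquad u|_{x_2=\pm\varepsilon/2}=0,\qquad u\ \text{$1$-periodic in }x_1,$$ is a $u\in H_{per}(D_\varepsilon)$ with $\int_{D_\varepsilon}\nu\,\mathcal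 D u:\mathcal D\psi=\int_{D_\varepsilon}f_1\psi_1$ for all $\psi\in H_{per}(D_\varepsilon)$; an associated pressure is a distribution $p\in\mathcal D'(D_\varepsilon)$ such that the first equation holds in $\mathcal D'(D_\varepsilon)$. Asymptotic solution. The regular ansatz of order $k$ is $$u_1^k=\sum_{j=0}^k\varepsilon^{j+2}u_{1,j}\Big(x_1,\frac{x_2}\varepsilon\Big),\quad u_2^k=\sum_{j=0}^k\varepsilon^{j+3}u_{2,j}\Big(x_1,\frac{x_2}\varepsilon\Big),\quad p^k=\sum_{j=0}^k\varepsilon^{j+1}p_j\Big(x_1,\frac{x_2}\varepsilon\Big)+\sum_{j=0}^k\varepsilon^jq_j(x_1),$$ where $u_{1,j},u_{2,j}$ (of class $C^2$) and $p_j,q_j$ (of class $C^1$), functions of $(x_1,\xi_2)\in\mathbb R\times[-\frac12,\frac12]$ (of $x_1$ only, for $q_j$) that are $1$-periodic in $x_1$, satisfy $\int_{-1/2}^{1/2}p_j\,d\xi_2=0$ and, for $0\le j\le k$ (functions with a negative index being $0$), $$-\partial_{x_1}(\nu\,\partial_{x_1}u_{1,j-2})-\tfrac{\nu}{2}\partial_{\xi_2}^2u_{1,j}-\tfrac{\nu}{2}\partial_{\xi_2}\partial_{x_1}u_{2,j-2}+\partial_{x_1}p_{j-1}+\partial_{x_1}q_j=f_1\delta_{j0},$$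 $$\tfrac12\partial_{x_1}\big[\nu(\partial_{\xi_2}u_{1,j-1}+\partial_{x_1}u_{2,j-3})\big]+\nu\,\partial_{\xi_2}^2u_{2,j-1}-\partial_{\xi_2}p_j=0,$$ $$\partial_{x_1}u_{1,j}+\partial_{\xi_2}u_{2,j}=0,\qquad u_{1,j}(x_1,\pm\tfrac12)=u_{2,j}(x_1,\pm\tfrac12)=0.$$ Then: 1. If $\nu\in C^\infty(\mathbb R)$, or if $k\le1$, such coefficients exist. 2. For every such family of coefficients there is a constant $C$, independent of $\varepsilon$, such that for every $\varepsilon\in(0,1]$, every weak solution $u$ and every associated pressure $p$, $$\|u^k-u\|_{(H^1(D_\varepsilon))^2}\le C\,\varepsilon^{k+5/2},\qquad \|\nabla p^k-\nabla p\|_{H^{-1}(D_\varepsilon)}\le C\,\varepsilon^{k+5/2},$$ where $H^{-1}(D_\varepsilon)$ is the dual of $(H^1_0(D_\varepsilon))^2$ normed by $\|\nabla\psi\|_{L^2(D_\varepsilon)}$. -/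

import Mathlib

open MeasureTheory TopologicalSpace
open scoped ENNReal ContDiff Distributions LineDeriv

noncomputable section

namespace ThinStokes

/-- The coordinate directions of the plane. -/
def dir (i : Fin 2) : ℝ × ℝ := if i = 0 then (1, 0) else (0, 1)

/-- Classical partial derivative of a function on the plane. -/
def pd (i : Fin 2) (w : ℝ × ℝ → ℝ) (x : ℝ × ℝ) : ℝ := fderiv ℝ w x (dir i)

/-- The thin domain `D_ε = (0,1) × (-ε/2, ε/2)`. -/
def strip (ε : ℝ) : Opens (ℝ × ℝ) :=
  ⟨Set.Ioo 0 1 ×ˢ Set.Ioo (-(ε / 2)) (ε / 2), isOpen_Ioo.prod isOpen_Ioo⟩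

/-- Lebesgue measure on an open set. -/
abbrev vol (Ω : Opens (ℝ × ℝ)) : Measure (ℝ × ℝ) := volume.restrict (Ω : Set (ℝ × ℝ))

/-! ### Sobolev norms -/

/-- `w ∈ H¹(Ω)`, with weak partial derivatives `g 0, g 1`. -/
structure HasWeakGrad (Ω : Opens (ℝ × ℝ)) (w : ℝ × ℝ → ℝ) (g : Fin 2 → ℝ × ℝ → ℝ) : Prop where
  memLp : MemLp w 2 (vol Ω)
  memLp_grad : ∀ j, MemLp (g j) 2 (vol Ω)
  weak : ∀ (j : Fin 2) (φ : 𝓓(Ω, ℝ)),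
    ∫ x in (Ω : Set (ℝ × ℝ)), w x * pd j φ x = -∫ x in (Ω : Set (ℝ × ℝ)), g j x * φ x

/-- The `H¹(Ω)²` norm of a vector field; it is `∞` if the field is not in `H¹(Ω)²`.
(Weak gradients are unique almost everywhere, so the infimum is over a single value.) -/
def h1Norm (Ω : Opens (ℝ × ℝ)) (w : Fin 2 → ℝ × ℝ → ℝ) : ℝ≥0∞ :=
  ⨅ (G : Fin 2 → Fin 2 → ℝ × ℝ → ℝ) (_ : ∀ i, HasWeakGrad Ω (w i) (G i)),
    (∑ i, (eLpNorm (w i) 2 (vol Ω) ^ 2 + ∑ j, eLpNorm (G i j) 2 (vol Ω) ^ 2)) ^ (1 / 2 : ℝ)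

/-- The `H⁻¹(Ω)` norm of a vector distribution (dual to `H¹₀(Ω)²`, the closure of the test
fields, with the norm `‖∇φ‖_{L²}`); it is `∞` if the distribution is not in `H⁻¹(Ω)²`. -/
def hMinusOneNorm (Ω : Opens (ℝ × ℝ)) (T : Fin 2 → 𝓓'(Ω, ℝ)) : ℝ≥0∞ :=
  ⨆ (φ : Fin 2 → 𝓓(Ω, ℝ))
    (_ : ∑ i, ∑ j, ∫ x in (Ω : Set (ℝ × ℝ)), (pd j (φ i) x) ^ 2 ≤ 1),
    ENNReal.ofReal |∑ i, T i (φ i)|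

/-- The distribution `φ ↦ ∫ g φ` on `Ω` given by a (locally integrable) function `g`. -/
def funDistribution (Ω : Opens (ℝ × ℝ)) (g : ℝ × ℝ → ℝ) : 𝓓'(Ω, ℝ) :=
  UniformConvergenceCLM.ofFun _ _ _
    (TestFunction.integralAgainstBilinCLM (ContinuousLinearMap.mul ℝ ℝ) volume g)

/-- The distributional gradient. -/
def grad {Ω : Opens (ℝ × ℝ)} (T : 𝓓'(Ω, ℝ)) (i : Fin 2) : 𝓓'(Ω, ℝ) := ∂_{dir i} T

/-! ### The periodic Stokes problem -/

/-- Functions smooth up to the boundary of `ℝ × [-ε/2, ε/2]`, `1`-periodic in `x₁` and vanishing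
for `x₂ = ± ε/2`. -/
structure IsPerSmooth (ε : ℝ) (φ : ℝ × ℝ → ℝ) : Prop where
  smooth : ContDiff ℝ ∞ φ
  periodic : ∀ s, ∀ t ∈ Set.Icc (-(ε / 2)) (ε / 2), φ (s + 1, t) = φ (s, t)
  top : ∀ s, φ (s, ε / 2) = 0
  bot : ∀ s, φ (s, -(ε / 2)) = 0

/-- `w ∈ H¹_{per,1,0}(D_ε)` with gradient `g`: the pair `(w, g)` is an `L²(D_ε)` limit of pairs
`(φ, ∇φ)` with `φ` as in `IsPerSmooth`. -/
structure MemHPer10 (ε : ℝ) (w : ℝ × ℝ → ℝ) (g : Fin 2 → ℝ × ℝ → ℝ) : Prop where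
  memLp : MemLp w 2 (vol (strip ε))
  memLp_grad : ∀ j, MemLp (g j) 2 (vol (strip ε))
  approx : ∀ δ : ℝ≥0∞, 0 < δ → ∃ φ, IsPerSmooth ε φ ∧
    eLpNorm (φ - w) 2 (vol (strip ε)) < δ ∧
    ∀ j, eLpNorm (pd j φ - g j) 2 (vol (strip ε)) < δ

/-- `v ∈ H_per(D_ε)`, the divergence-free fields in `H¹_{per,1,0}(D_ε)²`; here `G i j` is
`∂v_i/∂x_j`. -/
structure MemHPer (ε : ℝ) (v : Fin 2 → ℝ × ℝ → ℝ) (G : Fin 2 → Fin 2 → ℝ × ℝ → ℝ) : Prop where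
  comp : ∀ i, MemHPer10 ε (v i) (G i)
  div_free : ∀ᵐ x ∂(vol (strip ε)), G 0 0 x + G 1 1 x = 0

/-- The symmetrized gradient. -/
def symGrad (G : Fin 2 → Fin 2 → ℝ × ℝ → ℝ) (i j : Fin 2) (x : ℝ × ℝ) : ℝ :=
  (G i j x + G j i x) / 2

/-- The force `f₁(x₁) e₁`. -/
def force (f₁ : ℝ → ℝ) (i : Fin 2) (x : ℝ × ℝ) : ℝ := if i = 0 then f₁ x.1 else 0

/-- `u`, with gradient `G`, is the weak solution of the periodic Stokes problem in `D_ε` with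
viscosity `ν(x₁)` and force `f₁(x₁) e₁`. -/
structure IsWeakSolution (ν f₁ : ℝ → ℝ) (ε : ℝ) (u : Fin 2 → ℝ × ℝ → ℝ)
    (G : Fin 2 → Fin 2 → ℝ × ℝ → ℝ) : Prop where
  mem : MemHPer ε u G
  weak : ∀ ψ Ψ, MemHPer ε ψ Ψ →
    ∫ x in (strip ε : Set (ℝ × ℝ)), ν x.1 * ∑ i, ∑ j, symGrad G i j x * symGrad Ψ i j x =
      ∫ x in (strip ε : Set (ℝ × ℝ)), ∑ i, force f₁ i x * ψ i x

/-- `p` is a pressure for the velocity with gradient `G`: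
`-div(ν 𝒟u) + ∇p = f₁ e₁` in the sense of distributions on `D_ε`. -/
def IsPressure (ν f₁ : ℝ → ℝ) (ε : ℝ) (G : Fin 2 → Fin 2 → ℝ × ℝ → ℝ)
    (p : 𝓓'(strip ε, ℝ)) : Prop :=
  ∀ (i : Fin 2) (φ : 𝓓(strip ε, ℝ)),
    (∑ j, ∫ x in (strip ε : Set (ℝ × ℝ)), ν x.1 * symGrad G i j x * pd j φ x) + grad p i φ =
      ∫ x in (strip ε : Set (ℝ × ℝ)), force f₁ i x * φ x

/-! ### The regular ansatz -/

/-- Coefficients of the ansatz: `u₁ j`, `u₂ j`, `p j` are functions of `(x₁, ξ₂)` and `q j` of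
`x₁`. Only their values for `|ξ₂| ≤ 1/2` matter. -/
structure Coeffs where
  u₁ : ℕ → ℝ × ℝ → ℝ
  u₂ : ℕ → ℝ × ℝ → ℝ
  p : ℕ → ℝ × ℝ → ℝ
  q : ℕ → ℝ → ℝ

/-- The coefficient of index `j - m`, which is zero if `j - m` is negative. -/
def back (w : ℕ → ℝ × ℝ → ℝ) (j m : ℕ) : ℝ × ℝ → ℝ := if m ≤ j then w (j - m) else 0

/-- The coefficients of the ansatz of order `k`: periodic classical solutions, for `j ≤ k`, of the
recurrent system obtained by equating the powers of `ε`. -/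
structure IsAnsatz (ν f₁ : ℝ → ℝ) (k : ℕ) (a : Coeffs) : Prop where
  smooth_u₁ : ∀ j ≤ k, ContDiff ℝ 2 (a.u₁ j)
  smooth_u₂ : ∀ j ≤ k, ContDiff ℝ 2 (a.u₂ j)
  smooth_p : ∀ j ≤ k, ContDiff ℝ 1 (a.p j)
  smooth_q : ∀ j ≤ k, ContDiff ℝ 1 (a.q j)
  per_u₁ : ∀ j ≤ k, ∀ s, ∀ ξ ∈ Set.Icc (-(1 / 2) : ℝ) (1 / 2), a.u₁ j (s + 1, ξ) = a.u₁ j (s, ξ)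
  per_u₂ : ∀ j ≤ k, ∀ s, ∀ ξ ∈ Set.Icc (-(1 / 2) : ℝ) (1 / 2), a.u₂ j (s + 1, ξ) = a.u₂ j (s, ξ)
  per_p : ∀ j ≤ k, ∀ s, ∀ ξ ∈ Set.Icc (-(1 / 2) : ℝ) (1 / 2), a.p j (s + 1, ξ) = a.p j (s, ξ)
  per_q : ∀ j ≤ k, Function.Periodic (a.q j) 1
  mean_p : ∀ j ≤ k, ∀ s, ∫ ξ in (-(1 / 2) : ℝ)..(1 / 2), a.p j (s, ξ) = 0
  momentum₁ : ∀ j ≤ k, ∀ x : ℝ × ℝ, x.2 ∈ Set.Ioo (-(1 / 2) : ℝ) (1 / 2) →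
    -pd 0 (fun y => ν y.1 * pd 0 (back a.u₁ j 2) y) x
      - ν x.1 / 2 * pd 1 (pd 1 (a.u₁ j)) x
      - ν x.1 / 2 * pd 1 (pd 0 (back a.u₂ j 2)) x
      + pd 0 (back a.p j 1) x + deriv (a.q j) x.1 = if j = 0 then f₁ x.1 else 0
  momentum₂ : ∀ j ≤ k, ∀ x : ℝ × ℝ, x.2 ∈ Set.Ioo (-(1 / 2) : ℝ) (1 / 2) →
    1 / 2 * pd 0 (fun y => ν y.1 * (pd 1 (back a.u₁ j 1) y + pd 0 (back a.u₂ j 3) y)) x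
      + ν x.1 * pd 1 (pd 1 (back a.u₂ j 1)) x - pd 1 (a.p j) x = 0
  incompressible : ∀ j ≤ k, ∀ x : ℝ × ℝ, x.2 ∈ Set.Ioo (-(1 / 2) : ℝ) (1 / 2) →
    pd 0 (a.u₁ j) x + pd 1 (a.u₂ j) x = 0
  bdry_u₁ : ∀ j ≤ k, ∀ s, a.u₁ j (s, 1 / 2) = 0 ∧ a.u₁ j (s, -(1 / 2)) = 0
  bdry_u₂ : ∀ j ≤ k, ∀ s, a.u₂ j (s, 1 / 2) = 0 ∧ a.u₂ j (s, -(1 / 2)) = 0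

/-- The velocity `u^k` of the ansatz. -/
def Coeffs.velocity (a : Coeffs) (k : ℕ) (ε : ℝ) (i : Fin 2) (x : ℝ × ℝ) : ℝ :=
  if i = 0 then ∑ j ∈ Finset.range (k + 1), ε ^ (j + 2) * a.u₁ j (x.1, x.2 / ε)
  else ∑ j ∈ Finset.range (k + 1), ε ^ (j + 3) * a.u₂ j (x.1, x.2 / ε)

/-- The pressure `p^k` of the ansatz. -/
def Coeffs.pressure (a : Coeffs) (k : ℕ) (ε : ℝ) (x : ℝ × ℝ) : ℝ :=
  ∑ j ∈ Finset.range (k + 1), ε ^ (j + 1) * a.p j (x.1, x.2 / ε) +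
    ∑ j ∈ Finset.range (k + 1), ε ^ j * a.q j x.1

end ThinStokes

end

noncomputable section

namespace ThinStokes

/-! ### Square integrable functions -/

section SquareIntegrable

variable {α : Type*} {m : MeasurableSpace α} {μ : Measure α} {a b : α → ℝ}

/-! The estimate is an energy estimate for a nearly exact solution. The ansatz `(U, P)` is a
classical pair: periodic, zero on the horizontal walls, and exactly divergence-free, because the
incompressibility relations balance power by power (`IsAnsatz.isClassicalPair`). In the momentum
equation the recurrent system cancels the powers of ε up to `k`, so the residual is at most a
constant times ε^(k+1), uniformly on the strip (`IsAnsatz.exists_residual_zero_bound`,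
`IsAnsatz.exists_residual_one_bound`).

Let `W` be the gradient of the error `U - u`. Testing with the error itself removes the pressure and
leaves ∫ ν |sym W|² = ∫ residual · (U - u). Korn's inequality with constant 2
(`dirichlet_le_symGrad`) bounds the left side below by (κ/2)‖W‖². On the right, the strip has area
ε, so the residual has L² norm of order ε^(k+1) √ε, and the Poincaré inequality gives ‖U - u‖ ≤ ε
‖W‖ up to a constant. Hence ‖W‖ is of order ε^(k+5/2) (`sqrt_dirichlet_error_le`). Testing with
arbitrary compactly supported fields shows that ∇(P - p) is the residual plus the divergence of ν
sym W, and the same two bounds control it in H⁻¹ (`hMinusOneNorm_error_le`).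

The exact solution lies in a closure of smooth periodic functions, so integration by parts, Poincaré
and the null Lagrangian identity are proved for smooth functions and passed to the limit. The ansatz
is only C² and periodic only over the closed strip; that it belongs to the same closure is a density
statement (`memHPer10_of_contDiff`).

For existence with smooth ν, a stream function `Q` with u₁ = ∂₂Q and u₂ = -∂₁Q turns each index into
a third-order ordinary differential equation in ξ₂. The slope q' is fixed by making the flux
constant in x₁, and the value of that flux by making q periodic (`exists_stream_function`).
Everything stays polynomial in ξ₂ with smooth periodic coefficients, so the recursion never stops.
For `k ≤ 1` an explicit Poiseuille profile suffices and costs only one derivative of ν. -/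

lemma integrable_mul_of_memLp (ha : MemLp a 2 μ) (hb : MemLp b 2 μ) :
    Integrable (fun x => a x * b x) μ :=
  ha.integrable_mul hb

lemma integrable_sq_of_memLp (ha : MemLp a 2 μ) : Integrable (fun x => a x ^ 2) μ :=
  ha.integrable_sq

/-- Cauchy–Schwarz by the discriminant of the nonnegative quadratic t ↦ ∫ (t a + b)². -/
lemma sq_integral_mul_le (ha : MemLp a 2 μ) (hb : MemLp b 2 μ) :
    (∫ x, a x * b x ∂μ) ^ 2 ≤ (∫ x, a x ^ 2 ∂μ) * ∫ x, b x ^ 2 ∂μ := by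
  have h : ∀ t : ℝ, 0 ≤ (∫ x, a x ^ 2 ∂μ) * (t * t) + (2 * ∫ x, a x * b x ∂μ) * t
      + ∫ x, b x ^ 2 ∂μ := by
    intro t
    have e : ∫ x, (t * a x + b x) ^ 2 ∂μ = (∫ x, a x ^ 2 ∂μ) * (t * t)
        + (2 * ∫ x, a x * b x ∂μ) * t + ∫ x, b x ^ 2 ∂μ := by
      have : ∀ x, (t * a x + b x) ^ 2 = a x ^ 2 * (t * t) + a x * b x * (2 * t) + b x ^ 2 :=
        fun x => by ring
      simp_rw [this]
      have i₁ := (integrable_sq_of_memLp ha).mul_const (t * t)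
      have i₂ := (integrable_mul_of_memLp ha hb).mul_const (2 * t)
      have i₃ : Integrable (fun x => a x ^ 2 * (t * t) + a x * b x * (2 * t)) μ := i₁.add i₂
      rw [integral_add i₃ (integrable_sq_of_memLp hb), integral_add i₁ i₂,
        integral_mul_const, integral_mul_const]
      ring
    rw [← e]
    exact integral_nonneg fun x => sq_nonneg _
  have := discrim_le_zero h
  rw [discrim] at this
  nlinarith

lemma abs_integral_mul_le (ha : MemLp a 2 μ) (hb : MemLp b 2 μ) :
    |∫ x, a x * b x ∂μ| ≤ √(∫ x, a x ^ 2 ∂μ) * √(∫ x, b x ^ 2 ∂μ) := by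
  rw [← Real.sqrt_sq_eq_abs, ← Real.sqrt_mul (integral_nonneg fun x => sq_nonneg _)]
  exact Real.sqrt_le_sqrt (sq_integral_mul_le ha hb)

lemma eLpNorm_two_sq (ha : MemLp a 2 μ) :
    eLpNorm a 2 μ ^ 2 = ENNReal.ofReal (∫ x, a x ^ 2 ∂μ) := by
  rw [ha.eLpNorm_eq_integral_rpow_norm (by norm_num) (by norm_num),
    ← ENNReal.ofReal_pow (by positivity)]
  congr 1
  have h0 : (0 : ℝ) ≤ ∫ x, a x ^ 2 ∂μ := integral_nonneg fun x => sq_nonneg _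
  simp only [ENNReal.toReal_ofNat, Real.rpow_ofNat, Real.norm_eq_abs, sq_abs]
  rw [← one_div, ← Real.sqrt_eq_rpow]
  exact Real.sq_sqrt h0

/-- Converts the extended-real approximation clause of `MemHPer10` into convergence of real
integrals, the form in which limits are taken later. -/
lemma tendsto_integral_sq_of_eLpNorm {f : ℕ → α → ℝ} (hf : ∀ n, MemLp (f n) 2 μ)
    (h : ∀ n : ℕ, eLpNorm (f n) 2 μ < ENNReal.ofReal (1 / (n + 1))) :
    Filter.Tendsto (fun n => ∫ x, f n x ^ 2 ∂μ) Filter.atTop (nhds 0) := by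
  have hle : ∀ n : ℕ, ∫ x, f n x ^ 2 ∂μ ≤ 1 / ((n : ℝ) + 1) := by
    intro n
    have hn : (0 : ℝ) < 1 / ((n : ℝ) + 1) := by positivity
    have h1 : eLpNorm (f n) 2 μ ^ 2 ≤ ENNReal.ofReal (1 / (n + 1)) ^ 2 := by
      gcongr
      exact (h n).le
    rw [eLpNorm_two_sq (hf n), ← ENNReal.ofReal_pow hn.le,
      ENNReal.ofReal_le_ofReal_iff (by positivity)] at h1
    have h2 : 1 / ((n : ℝ) + 1) ≤ 1 := by
      rw [div_le_one (by positivity)]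
      have : (0 : ℝ) ≤ n := n.cast_nonneg
      linarith
    nlinarith
  exact squeeze_zero (fun n => integral_nonneg fun x => sq_nonneg _) hle
    tendsto_one_div_add_atTop_nhds_zero_nat

lemma tendsto_integral_mul {f : ℕ → α → ℝ} (ha : MemLp a 2 μ) (hb : MemLp b 2 μ)
    (hf : ∀ n, MemLp (f n) 2 μ)
    (h : Filter.Tendsto (fun n => ∫ x, (f n x - b x) ^ 2 ∂μ) Filter.atTop (nhds 0)) :
    Filter.Tendsto (fun n => ∫ x, a x * f n x ∂μ) Filter.atTop (nhds (∫ x, a x * b x ∂μ)) := by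
  rw [tendsto_iff_norm_sub_tendsto_zero]
  have hs : Filter.Tendsto (fun n => √(∫ x, a x ^ 2 ∂μ) * √(∫ x, (f n x - b x) ^ 2 ∂μ))
      Filter.atTop (nhds 0) := by
    have := (h.sqrt).const_mul (√(∫ x, a x ^ 2 ∂μ))
    simpa using this
  refine squeeze_zero (fun n => norm_nonneg _) (fun n => ?_) hs
  rw [← integral_sub (integrable_mul_of_memLp ha (hf n)) (integrable_mul_of_memLp ha hb)]
  simp_rw [← mul_sub]
  exact abs_integral_mul_le ha ((hf n).sub hb)

lemma tendsto_integral_sq {f : ℕ → α → ℝ} (hb : MemLp b 2 μ) (hf : ∀ n, MemLp (f n) 2 μ)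
    (h : Filter.Tendsto (fun n => ∫ x, (f n x - b x) ^ 2 ∂μ) Filter.atTop (nhds 0)) :
    Filter.Tendsto (fun n => ∫ x, f n x ^ 2 ∂μ) Filter.atTop (nhds (∫ x, b x ^ 2 ∂μ)) := by
  have e : ∀ n, ∫ x, f n x ^ 2 ∂μ = ∫ x, (f n x - b x) ^ 2 ∂μ
      + 2 * (∫ x, b x * f n x ∂μ) - ∫ x, b x * b x ∂μ := by
    intro n
    have i₁ := integrable_sq_of_memLp ((hf n).sub hb)
    have i₂ := (integrable_mul_of_memLp hb (hf n)).const_mul 2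
    simp only [Pi.sub_apply] at i₁
    have i₃ : Integrable (fun x => (f n x - b x) ^ 2 + 2 * (b x * f n x)) μ := i₁.add i₂
    rw [← integral_const_mul, ← integral_add i₁ i₂,
      ← integral_sub i₃ (integrable_mul_of_memLp hb hb)]
    congr 1
    ext x
    ring
  have := (h.add ((tendsto_integral_mul hb hb hf h).const_mul 2)).sub_const (∫ x, b x * b x ∂μ)
  simp_rw [e]
  convert this using 2
  simp_rw [pow_two]
  ring

end SquareIntegrable

/-! ### Partial derivatives -/

section PartialDerivatives

variable {v w : ℝ × ℝ → ℝ} {x : ℝ × ℝ} {i j : Fin 2}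

lemma contDiff_pd {n m : WithTop ℕ∞} (hw : ContDiff ℝ n w) (h : m + 1 ≤ n) (i : Fin 2) :
    ContDiff ℝ m (pd i w) :=
  (hw.fderiv_right h).clm_apply contDiff_const

lemma continuous_pd (hw : ContDiff ℝ 1 w) (i : Fin 2) : Continuous (pd i w) :=
  (contDiff_pd (m := 0) hw (by norm_num) i).continuous

lemma pd_add (hv : DifferentiableAt ℝ v x) (hw : DifferentiableAt ℝ w x) :
    pd i (fun y => v y + w y) x = pd i v x + pd i w x := by
  simp only [pd, fderiv_fun_add hv hw, _root_.add_apply]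

lemma pd_sub (hv : DifferentiableAt ℝ v x) (hw : DifferentiableAt ℝ w x) :
    pd i (fun y => v y - w y) x = pd i v x - pd i w x := by
  simp only [pd, fderiv_fun_sub hv hw, _root_.sub_apply]

lemma pd_neg : pd i (fun y => -w y) x = -pd i w x := by
  simp only [pd, fderiv_fun_neg, _root_.neg_apply]

lemma pd_mul (hv : DifferentiableAt ℝ v x) (hw : DifferentiableAt ℝ w x) :
    pd i (fun y => v y * w y) x = v x * pd i w x + pd i v x * w x := by
  simp only [pd, fderiv_fun_mul hv hw, _root_.add_apply,
    _root_.smul_apply, smul_eq_mul]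
  ring

lemma pd_const_mul (c : ℝ) (hw : DifferentiableAt ℝ w x) :
    pd i (fun y => c * w y) x = c * pd i w x := by
  simp only [pd, fderiv_const_mul hw, _root_.smul_apply, smul_eq_mul]

lemma pd_sum {ι : Type*} (s : Finset ι) {f : ι → ℝ × ℝ → ℝ}
    (hf : ∀ n ∈ s, DifferentiableAt ℝ (f n) x) :
    pd i (fun y => ∑ n ∈ s, f n y) x = ∑ n ∈ s, pd i (f n) x := by
  simp only [pd, fderiv_fun_sum hf, _root_.sum_apply]

lemma pd_zero : pd i (0 : ℝ × ℝ → ℝ) = 0 := by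
  funext x
  simp [pd]

lemma pd_const (c : ℝ) : pd i (fun _ => c) x = 0 := by
  simp [pd]

lemma hasDerivAt_fst (hw : DifferentiableAt ℝ w x) :
    HasDerivAt (fun s => w (s, x.2)) (pd 0 w x) x.1 := by
  have h : HasDerivAt (fun s : ℝ => (s, x.2)) ((1 : ℝ), (0 : ℝ)) x.1 :=
    (hasDerivAt_id _).prodMk (hasDerivAt_const _ _)
  exact (hw.hasFDerivAt (x := x)).comp_hasDerivAt (x := x.1) (f := fun s => (s, x.2)) h

lemma hasDerivAt_snd (hw : DifferentiableAt ℝ w x) :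
    HasDerivAt (fun t => w (x.1, t)) (pd 1 w x) x.2 := by
  have h : HasDerivAt (fun t : ℝ => (x.1, t)) ((0 : ℝ), (1 : ℝ)) x.2 :=
    (hasDerivAt_const _ _).prodMk (hasDerivAt_id _)
  exact (hw.hasFDerivAt (x := x)).comp_hasDerivAt (x := x.2) (f := fun t => (x.1, t)) h

lemma pd_fst_eq {c : ℝ} (hw : DifferentiableAt ℝ w x)
    (h : HasDerivAt (fun s => w (s, x.2)) c x.1) : pd 0 w x = c :=
  (hasDerivAt_fst hw).unique h

lemma pd_snd_eq {c : ℝ} (hw : DifferentiableAt ℝ w x)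
    (h : HasDerivAt (fun t => w (x.1, t)) c x.2) : pd 1 w x = c :=
  (hasDerivAt_snd hw).unique h

lemma pd_comm (hw : ContDiff ℝ 2 w) : pd i (pd j w) x = pd j (pd i w) x := by
  have hd : DifferentiableAt ℝ (fderiv ℝ w) x :=
    ((hw.fderiv_right (m := 1) (by norm_num)).differentiable (by norm_num)) x
  have h : ∀ i j, pd i (pd j w) x = fderiv ℝ (fderiv ℝ w) x (dir i) (dir j) := by
    intro i j
    change fderiv ℝ (fun y => fderiv ℝ w y (dir j)) x (dir i) = _
    rw [fderiv_clm_apply hd (differentiableAt_const _)]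
    simp
  rw [h, h]
  exact (hw.contDiffAt.isSymmSndFDerivAt (by simp)).eq _ _

lemma pd_congr {s : Set (ℝ × ℝ)} (hs : IsOpen s) (hx : x ∈ s) (h : ∀ y ∈ s, v y = w y) :
    pd i v x = pd i w x := by
  simp only [pd]
  rw [Filter.EventuallyEq.fderiv_eq (Filter.eventuallyEq_of_mem (hs.mem_nhds hx) h)]

lemma pd_translate (hw : Differentiable ℝ w) (c : ℝ) :
    pd i (fun y => w (y.1 + c, y.2)) x = pd i w (x.1 + c, x.2) := by
  have h : HasFDerivAt (fun y : ℝ × ℝ => (y.1 + c, y.2)) (ContinuousLinearMap.id ℝ (ℝ × ℝ)) x := by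
    have := (hasFDerivAt_id (𝕜 := ℝ) x).add_const ((c, 0) : ℝ × ℝ)
    refine this.congr_of_eventuallyEq (Filter.Eventually.of_forall fun y => ?_)
    ext <;> simp
  have := (hw (x.1 + c, x.2)).hasFDerivAt.comp x h
  simp only [pd]
  rw [show (fun y : ℝ × ℝ => w (y.1 + c, y.2)) = w ∘ fun y => (y.1 + c, y.2) from rfl,
    this.fderiv]
  simp

/-- Periodicity on an open strip is inherited by the partial derivatives. -/
lemma pd_periodic {ε : ℝ} (hw : Differentiable ℝ w)
    (h : ∀ s, ∀ t ∈ Set.Icc (-ε) ε, w (s + 1, t) = w (s, t)) (i : Fin 2) {t : ℝ}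
    (ht : t ∈ Set.Ioo (-ε) ε) (s : ℝ) : pd i w (s + 1, t) = pd i w (s, t) := by
  have := pd_translate (i := i) (x := (s, t)) hw 1
  rw [← this]
  -- The derivatives agree where the functions agree on a neighbourhood, hence only at interior
  -- heights, although the hypothesis covers the closed strip.
  refine pd_congr (s := Set.univ ×ˢ Set.Ioo (-ε) ε) (isOpen_univ.prod isOpen_Ioo) ⟨trivial, ht⟩ ?_
  rintro ⟨s', t'⟩ ⟨-, ht'⟩
  exact h s' t' ⟨ht'.1.le, ht'.2.le⟩

end PartialDerivatives

/-! ### Integration by parts on the strip -/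

section Strip

variable {ε : ℝ}

lemma mem_strip {x : ℝ × ℝ} :
    x ∈ (strip ε : Set (ℝ × ℝ)) ↔ x.1 ∈ Set.Ioo (0 : ℝ) 1 ∧ x.2 ∈ Set.Ioo (-(ε / 2)) (ε / 2) :=
  Iff.rfl

lemma measurableSet_strip : MeasurableSet (strip ε : Set (ℝ × ℝ)) := (strip ε).isOpen.measurableSet

lemma strip_subset_Icc :
    (strip ε : Set (ℝ × ℝ)) ⊆ Set.Icc ((0, -(ε / 2)) : ℝ × ℝ) (1, ε / 2) := fun _ hx =>
  ⟨⟨hx.1.1.le, hx.2.1.le⟩, ⟨hx.1.2.le, hx.2.2.le⟩⟩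

lemma volume_strip : volume (strip ε : Set (ℝ × ℝ)) = ENNReal.ofReal ε := by
  change volume (Set.Ioo (0 : ℝ) 1 ×ˢ Set.Ioo (-(ε / 2)) (ε / 2)) = _
  rw [Measure.volume_eq_prod, Measure.prod_prod, Real.volume_Ioo, Real.volume_Ioo]
  simp

instance isFiniteMeasure_vol_strip : IsFiniteMeasure (vol (strip ε)) :=
  ⟨by
    rw [Measure.restrict_apply_univ]
    exact (measure_mono strip_subset_Icc).trans_lt isCompact_Icc.measure_lt_top⟩

lemma exists_bound_strip {f : ℝ × ℝ → ℝ} (hf : Continuous f) :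
    ∃ C, 0 ≤ C ∧ ∀ x ∈ (strip ε : Set (ℝ × ℝ)), |f x| ≤ C := by
  obtain ⟨C, hC⟩ := (isCompact_Icc (a := ((0, -(ε / 2)) : ℝ × ℝ)) (b := (1, ε / 2))).exists_bound_of_continuousOn
    hf.continuousOn
  exact ⟨|C|, abs_nonneg _, fun x hx => (hC x (strip_subset_Icc hx)).trans (le_abs_self C)⟩

lemma memLp_of_bound {f : ℝ × ℝ → ℝ} (hf : AEStronglyMeasurable f (vol (strip ε))) {C : ℝ}
    (h : ∀ x ∈ (strip ε : Set (ℝ × ℝ)), |f x| ≤ C) : MemLp f 2 (vol (strip ε)) :=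
  MemLp.of_bound hf C ((ae_restrict_iff' measurableSet_strip).2 (Filter.Eventually.of_forall h))

lemma memLp_of_continuous {f : ℝ × ℝ → ℝ} (hf : Continuous f) : MemLp f 2 (vol (strip ε)) := by
  obtain ⟨C, -, hC⟩ := exists_bound_strip (ε := ε) hf
  exact memLp_of_bound hf.aestronglyMeasurable hC

lemma memLp_mul_of_continuous {f g : ℝ × ℝ → ℝ} (hf : Continuous f) (hg : MemLp g 2 (vol (strip ε))) :
    MemLp (fun x => f x * g x) 2 (vol (strip ε)) := by
  obtain ⟨C, -, hC⟩ := exists_bound_strip (ε := ε) hf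
  refine MemLp.of_le_mul (c := C) hg (hf.aestronglyMeasurable.mul hg.1) ?_
  refine (ae_restrict_iff' measurableSet_strip).2 (Filter.Eventually.of_forall fun x hx => ?_)
  rw [norm_mul]
  exact mul_le_mul_of_nonneg_right (hC x hx) (norm_nonneg _)

lemma setIntegral_strip_eq_Icc (f : ℝ × ℝ → ℝ) :
    ∫ x in (strip ε : Set (ℝ × ℝ)), f x = ∫ x in Set.Icc ((0, -(ε / 2)) : ℝ × ℝ) (1, ε / 2), f x := by
  refine setIntegral_congr_set ?_
  rw [← Set.Icc_prod_Icc, Measure.volume_eq_prod]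
  exact Measure.set_prod_ae_eq Ioo_ae_eq_Icc Ioo_ae_eq_Icc

/-- The data on the boundary under which a partial derivative integrates to zero. -/
lemma integral_pd_eq_zero (hε : 0 < ε) {h : ℝ × ℝ → ℝ} (hh : ContDiff ℝ 1 h)
    (top : ∀ s, h (s, ε / 2) = 0) (bot : ∀ s, h (s, -(ε / 2)) = 0)
    (sides : ∀ t ∈ Set.Ioo (-(ε / 2)) (ε / 2), h (1, t) = h (0, t)) (j : Fin 2) :
    ∫ x in (strip ε : Set (ℝ × ℝ)), pd j h x = 0 := by
  rw [setIntegral_strip_eq_Icc]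
  have hle : ((0, -(ε / 2)) : ℝ × ℝ) ≤ (1, ε / 2) :=
    ⟨zero_le_one, by change -(ε / 2) ≤ ε / 2; linarith⟩
  have hd : ∀ x, HasFDerivAt h (fderiv ℝ h x) x := fun x =>
    ((hh.differentiable (by norm_num)) x).hasFDerivAt
  have h0 : ∀ x, HasFDerivAt (fun _ : ℝ × ℝ => (0 : ℝ)) (0 : ℝ × ℝ →L[ℝ] ℝ) x := fun x =>
    hasFDerivAt_const _ _
  have hi : ∀ i, IntegrableOn (pd i h) (Set.Icc ((0, -(ε / 2)) : ℝ × ℝ) (1, ε / 2)) := fun i =>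
    (continuous_pd hh i).continuousOn.integrableOn_compact isCompact_Icc
  -- The vertical sides match on the open interval only; the two corners are negligible.
  have sides' : ∫ t in (-(ε / 2))..(ε / 2), h (1, t) = ∫ t in (-(ε / 2))..(ε / 2), h (0, t) := by
    rw [intervalIntegral.integral_of_le (by linarith), intervalIntegral.integral_of_le (by linarith),
      integral_Ioc_eq_integral_Ioo, integral_Ioc_eq_integral_Ioo]
    exact setIntegral_congr_fun measurableSet_Ioo sides
  fin_cases j
  -- Divergence theorem for the field (h, 0), and below for (0, h): the boundary terms cancel
  -- between the vertical sides, or vanish on the horizontal ones.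
  · have := integral_divergence_prod_Icc_of_hasFDerivAt_of_le h (fun _ => 0) (fderiv ℝ h) (fun _ => 0)
      _ _ hle hh.continuous.continuousOn continuousOn_const (fun x _ => hd x) (fun x _ => h0 x)
      (by simp only [_root_.zero_apply, add_zero]; exact hi 0)
    simpa [pd, dir, sides'] using this
  · have := integral_divergence_prod_Icc_of_hasFDerivAt_of_le (fun _ => 0) h (fun _ => 0) (fderiv ℝ h)
      _ _ hle continuousOn_const hh.continuous.continuousOn (fun x _ => h0 x) (fun x _ => hd x)
      (by simp only [_root_.zero_apply, zero_add]; exact hi 1)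
    simpa [pd, dir, top, bot] using this

/-- A `C¹` function vanishing on the horizontal sides and matching on the vertical ones. -/
structure IsStripTest (ε : ℝ) (φ : ℝ × ℝ → ℝ) : Prop where
  smooth : ContDiff ℝ 1 φ
  sides : ∀ t ∈ Set.Ioo (-(ε / 2)) (ε / 2), φ (1, t) = φ (0, t)
  top : ∀ s, φ (s, ε / 2) = 0
  bot : ∀ s, φ (s, -(ε / 2)) = 0

lemma IsPerSmooth.isStripTest {φ : ℝ × ℝ → ℝ} (h : IsPerSmooth ε φ) : IsStripTest ε φ where
  smooth := h.smooth.of_le (by exact_mod_cast le_top)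
  sides t ht := by simpa using h.periodic 0 t ⟨ht.1.le, ht.2.le⟩
  top := h.top
  bot := h.bot

lemma testFunction_eq_zero (φ : 𝓓(strip ε, ℝ)) {x : ℝ × ℝ} (hx : x ∉ (strip ε : Set (ℝ × ℝ))) :
    φ x = 0 := by
  by_contra h
  exact hx (φ.tsupport_subset (subset_tsupport _ h))

lemma contDiff_testFunction (φ : 𝓓(strip ε, ℝ)) : ContDiff ℝ 1 φ :=
  φ.contDiff.of_le (by exact_mod_cast le_top)

/-- The boundary lies outside the open strip, so every condition reads 0 = 0. This lets the H⁻¹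
estimate share integration by parts and Poincaré with the energy estimate. -/
lemma isStripTest_testFunction (φ : 𝓓(strip ε, ℝ)) : IsStripTest ε φ where
  smooth := contDiff_testFunction φ
  sides t _ := by
    rw [testFunction_eq_zero φ, testFunction_eq_zero φ] <;> simp [-SetLike.mem_coe, mem_strip]
  top s := testFunction_eq_zero φ (by simp [-SetLike.mem_coe, mem_strip])
  bot s := testFunction_eq_zero φ (by simp [-SetLike.mem_coe, mem_strip])

/-- `g` is the gradient of `w` in the sense of integration by parts against `C¹` functions that
match on the vertical sides of the strip. -/
def IntegratesByParts (ε : ℝ) (w : ℝ × ℝ → ℝ) (g : Fin 2 → ℝ × ℝ → ℝ) : Prop :=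
  ∀ a, ContDiff ℝ 1 a → (∀ t ∈ Set.Ioo (-(ε / 2)) (ε / 2), a (1, t) = a (0, t)) → ∀ j,
    ∫ x in (strip ε : Set (ℝ × ℝ)), a x * g j x = -∫ x in (strip ε : Set (ℝ × ℝ)), pd j a x * w x

/-- The product a φ has no boundary contribution: φ vanishes on the horizontal sides, so `a` need
only match on the vertical ones. This freedom is what admits the stress and the pressure as
multipliers. -/
lemma IsStripTest.integratesByParts (hε : 0 < ε) {φ : ℝ × ℝ → ℝ} (hφ : IsStripTest ε φ) :
    IntegratesByParts ε φ (fun j => pd j φ) := by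
  intro a ha hs j
  have h := integral_pd_eq_zero hε (h := fun x => a x * φ x) (ha.mul hφ.smooth)
    (fun s => by simp [hφ.top]) (fun s => by simp [hφ.bot])
    (fun t ht => by simp [hs t ht, hφ.sides t ht]) j
  simp_rw [fun x => pd_mul (i := j) (ha.differentiable (by norm_num) x)
    (hφ.smooth.differentiable (by norm_num) x)] at h
  rw [integral_add] at h
  · linarith
  · exact integrable_mul_of_memLp (memLp_of_continuous ha.continuous)
      (memLp_of_continuous (continuous_pd hφ.smooth j))
  · exact integrable_mul_of_memLp (memLp_of_continuous (continuous_pd ha j))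
      (memLp_of_continuous hφ.smooth.continuous)

/-- Integrating by parts with the multiplier x₂ φ gives ∫ φ² = -2 ∫ x₂ φ ∂₂φ. Since |x₂| ≤ ε/2,
Cauchy–Schwarz yields the constant ε². -/
lemma IsStripTest.integral_sq_le (hε : 0 < ε) {φ : ℝ × ℝ → ℝ} (hφ : IsStripTest ε φ) :
    ∫ x in (strip ε : Set (ℝ × ℝ)), φ x ^ 2 ≤
      ε ^ 2 * ∫ x in (strip ε : Set (ℝ × ℝ)), pd 1 φ x ^ 2 := by
  have hc := hφ.smooth.continuous
  have hc' := continuous_pd hφ.smooth 1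
  have h := hφ.integratesByParts hε (fun x => x.2 * φ x) (contDiff_snd.mul hφ.smooth)
    (fun t ht => by simp [hφ.sides t ht]) 1
  have e : ∀ x, pd 1 (fun x => x.2 * φ x) x = x.2 * pd 1 φ x + φ x := by
    intro x
    rw [pd_mul differentiableAt_snd (hφ.smooth.differentiable (by norm_num) x),
      pd_snd_eq (w := fun y => y.2) (c := 1) differentiableAt_snd (hasDerivAt_id _)]
    ring
  simp_rw [e] at h
  have e2 : ∀ x, (x.2 * pd 1 φ x + φ x) * φ x = x.2 * φ x * pd 1 φ x + φ x ^ 2 := fun x => by ring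
  simp_rw [e2] at h
  have hm : MemLp (fun x => x.2 * φ x) 2 (vol (strip ε)) :=
    memLp_of_continuous (continuous_snd.mul hc)
  rw [integral_add (integrable_mul_of_memLp hm (memLp_of_continuous hc'))
    (integrable_sq_of_memLp (memLp_of_continuous hc))] at h
  have hcs := sq_integral_mul_le hm (memLp_of_continuous (ε := ε) hc')
  have hle : ∫ x in (strip ε : Set (ℝ × ℝ)), (x.2 * φ x) ^ 2 ≤
      (ε / 2) ^ 2 * ∫ x in (strip ε : Set (ℝ × ℝ)), φ x ^ 2 := by
    rw [← integral_const_mul]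
    refine setIntegral_mono_on (integrable_sq_of_memLp hm)
      ((integrable_sq_of_memLp (memLp_of_continuous hc)).const_mul _) measurableSet_strip ?_
    intro x hx
    rw [mul_pow]
    refine mul_le_mul_of_nonneg_right ?_ (sq_nonneg _)
    exact sq_le_sq' hx.2.1.le hx.2.2.le
  set A := ∫ x in (strip ε : Set (ℝ × ℝ)), φ x ^ 2
  set B := ∫ x in (strip ε : Set (ℝ × ℝ)), pd 1 φ x ^ 2
  set I := ∫ x in (strip ε : Set (ℝ × ℝ)), x.2 * φ x * pd 1 φ x
  have hA : 0 ≤ A := integral_nonneg fun x => sq_nonneg _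
  have hB : 0 ≤ B := integral_nonneg fun x => sq_nonneg _
  have hI : A = -2 * I := by linarith
  have h3 : A * A ≤ ε ^ 2 * B * A := by
    have : I ^ 2 ≤ (ε / 2) ^ 2 * A * B := hcs.trans (mul_le_mul_of_nonneg_right hle hB)
    nlinarith
  -- The inequality obtained is A² ≤ ε² B A, so A = 0 is treated apart before dividing.
  rcases hA.eq_or_lt with h0 | h0
  · rw [← h0]; positivity
  · exact le_of_mul_le_mul_right h3 h0

end Strip

/-! ### The space of periodic functions vanishing on the horizontal boundary -/

section Periodic

variable {ε : ℝ} {w w' : ℝ × ℝ → ℝ} {g g' : Fin 2 → ℝ × ℝ → ℝ}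

lemma IsPerSmooth.memLp {φ : ℝ × ℝ → ℝ} (h : IsPerSmooth ε φ) : MemLp φ 2 (vol (strip ε)) :=
  memLp_of_continuous h.smooth.continuous

lemma IsPerSmooth.memLp_pd {φ : ℝ × ℝ → ℝ} (h : IsPerSmooth ε φ) (j : Fin 2) :
    MemLp (pd j φ) 2 (vol (strip ε)) :=
  memLp_of_continuous (continuous_pd h.isStripTest.smooth j)

lemma IsPerSmooth.sub {φ ψ : ℝ × ℝ → ℝ} (hφ : IsPerSmooth ε φ) (hψ : IsPerSmooth ε ψ) :
    IsPerSmooth ε (fun x => φ x - ψ x) where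
  smooth := hφ.smooth.sub hψ.smooth
  periodic s t ht := by rw [hφ.periodic s t ht, hψ.periodic s t ht]
  top s := by rw [hφ.top, hψ.top, sub_zero]
  bot s := by rw [hφ.bot, hψ.bot, sub_zero]

lemma MemHPer10.exists_seq (h : MemHPer10 ε w g) : ∃ φ : ℕ → ℝ × ℝ → ℝ,
    (∀ n, IsPerSmooth ε (φ n)) ∧
    Filter.Tendsto (fun n => ∫ x in (strip ε : Set (ℝ × ℝ)), (φ n x - w x) ^ 2)
      Filter.atTop (nhds 0) ∧
    ∀ j, Filter.Tendsto (fun n => ∫ x in (strip ε : Set (ℝ × ℝ)), (pd j (φ n) x - g j x) ^ 2)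
      Filter.atTop (nhds 0) := by
  choose φ hφ h₁ h₂ using fun n : ℕ =>
    h.approx (ENNReal.ofReal (1 / (n + 1))) (by rw [ENNReal.ofReal_pos]; positivity)
  exact ⟨φ, hφ, tendsto_integral_sq_of_eLpNorm (fun n => (hφ n).memLp.sub h.memLp) h₁,
    fun j => tendsto_integral_sq_of_eLpNorm
      (fun n => ((hφ n).memLp_pd j).sub (h.memLp_grad j)) fun n => h₂ n j⟩

/-- For a fixed C¹ multiplier both sides are L²-continuous in the pair (w, g), so the identity
survives the closure. -/
lemma MemHPer10.integratesByParts (hε : 0 < ε) (h : MemHPer10 ε w g) :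
    IntegratesByParts ε w g := by
  intro a ha hs j
  obtain ⟨φ, hφ, h₁, h₂⟩ := h.exists_seq
  have t₁ := tendsto_integral_mul (memLp_of_continuous ha.continuous) (h.memLp_grad j)
    (fun n => (hφ n).memLp_pd j) (h₂ j)
  have t₂ := (tendsto_integral_mul (memLp_of_continuous (continuous_pd ha j)) h.memLp
    (fun n => (hφ n).memLp) h₁).neg
  refine tendsto_nhds_unique t₁ (t₂.congr fun n => ?_)
  exact ((hφ n).isStripTest.integratesByParts hε a ha hs j).symm

/-- The Poincaré inequality in a thin strip. -/
lemma MemHPer10.integral_sq_le (hε : 0 < ε) (h : MemHPer10 ε w g) :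
    ∫ x in (strip ε : Set (ℝ × ℝ)), w x ^ 2 ≤ ε ^ 2 * ∫ x in (strip ε : Set (ℝ × ℝ)), g 1 x ^ 2 := by
  obtain ⟨φ, hφ, h₁, h₂⟩ := h.exists_seq
  have t₁ := tendsto_integral_sq h.memLp (fun n => (hφ n).memLp) h₁
  have t₂ := (tendsto_integral_sq (h.memLp_grad 1) (fun n => (hφ n).memLp_pd 1) (h₂ 1)).const_mul
    (ε ^ 2)
  exact le_of_tendsto_of_tendsto' t₁ t₂ fun n => (hφ n).isStripTest.integral_sq_le hε

lemma IsPerSmooth.pd_sides {φ : ℝ × ℝ → ℝ} (h : IsPerSmooth ε φ) (i : Fin 2) {t : ℝ}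
    (ht : t ∈ Set.Ioo (-(ε / 2)) (ε / 2)) : pd i φ (1, t) = pd i φ (0, t) := by
  simpa using pd_periodic (h.isStripTest.smooth.differentiable (by norm_num)) h.periodic i ht 0

/-- The null Lagrangian identity behind the Korn inequality. -/
lemma MemHPer10.integral_mul_comm (hε : 0 < ε) (h : MemHPer10 ε w g) (h' : MemHPer10 ε w' g') :
    ∫ x in (strip ε : Set (ℝ × ℝ)), g 1 x * g' 0 x = ∫ x in (strip ε : Set (ℝ × ℝ)), g 0 x * g' 1 x := by
  obtain ⟨φ, hφ, -, h₂⟩ := h'.exists_seq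
  have t₁ := tendsto_integral_mul (h.memLp_grad 1) (h'.memLp_grad 0)
    (fun n => (hφ n).memLp_pd 0) (h₂ 0)
  have t₂ := tendsto_integral_mul (h.memLp_grad 0) (h'.memLp_grad 1)
    (fun n => (hφ n).memLp_pd 1) (h₂ 1)
  refine tendsto_nhds_unique t₁ (t₂.congr fun n => ?_)
  have hs2 : ContDiff ℝ 2 (φ n) :=
    (hφ n).smooth.of_le (WithTop.coe_le_coe.2 (le_top : (2 : ℕ∞) ≤ ⊤))
  -- Only the second function is approximated. The derivatives of the smooth φ serve as multipliers,
  -- and both integrals become minus the integral of w against the same mixed second derivative.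
  have hs : ∀ i, ContDiff ℝ 1 (pd i (φ n)) := contDiff_pd hs2 (by norm_num)
  have e₁ := h.integratesByParts hε _ (hs 1) (fun t ht => (hφ n).pd_sides 1 ht) 0
  have e₂ := h.integratesByParts hε _ (hs 0) (fun t ht => (hφ n).pd_sides 0 ht) 1
  simp_rw [pd_comm (i := 0) (j := 1) hs2] at e₁
  simp_rw [mul_comm (g _ _)]
  rw [e₁, e₂]

lemma MemHPer10.sub (h : MemHPer10 ε w g) (h' : MemHPer10 ε w' g') :
    MemHPer10 ε (w - w') (fun j => g j - g' j) where
  memLp := h.memLp.sub h'.memLp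
  memLp_grad j := (h.memLp_grad j).sub (h'.memLp_grad j)
  approx δ hδ := by
    have hδ2 : 0 < δ / 2 := ENNReal.half_pos hδ.ne'
    obtain ⟨φ, hφ, a₁, a₂⟩ := h.approx _ hδ2
    obtain ⟨ψ, hψ, b₁, b₂⟩ := h'.approx _ hδ2
    have key : ∀ {p q r s : ℝ × ℝ → ℝ}, MemLp p 2 (vol (strip ε)) → MemLp q 2 (vol (strip ε)) →
        MemLp r 2 (vol (strip ε)) → MemLp s 2 (vol (strip ε)) →
        eLpNorm (p - q) 2 (vol (strip ε)) < δ / 2 → eLpNorm (r - s) 2 (vol (strip ε)) < δ / 2 →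
        eLpNorm ((p - r) - (q - s)) 2 (vol (strip ε)) < δ := by
      intro p q r s hp hq hr hs h₁ h₂
      rw [sub_sub_sub_comm]
      refine (eLpNorm_sub_le (hp.sub hq).1 (hr.sub hs).1 (by norm_num)).trans_lt ?_
      calc _ < δ / 2 + δ / 2 := ENNReal.add_lt_add h₁ h₂
        _ = δ := ENNReal.add_halves δ
    refine ⟨_, hφ.sub hψ, key hφ.memLp h.memLp hψ.memLp h'.memLp a₁ b₁, fun j => ?_⟩
    have e : pd j (fun x => φ x - ψ x) = pd j φ - pd j ψ := by
      funext x
      exact pd_sub (hφ.smooth.differentiable (by simp) x) (hψ.smooth.differentiable (by simp) x)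
    rw [e]
    exact key (hφ.memLp_pd j) (h.memLp_grad j) (hψ.memLp_pd j) (h'.memLp_grad j) (a₂ j) (b₂ j)

lemma MemHPer10.hasWeakGrad (hε : 0 < ε) (h : MemHPer10 ε w g) : HasWeakGrad (strip ε) w g where
  memLp := h.memLp
  memLp_grad := h.memLp_grad
  weak j φ := by
    have := h.integratesByParts hε φ (contDiff_testFunction φ) (isStripTest_testFunction φ).sides j
    simp_rw [mul_comm (w _), mul_comm (g _ _)]
    rw [this, neg_neg]

end Periodic

/-! ### Density of smooth functions -/

section Density

open scoped Convolution

variable {ε : ℝ} {w : ℝ × ℝ → ℝ}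

/-- The derivative is put on `v`, not on the kernel, so that gradients of mollifications are
compared with gradients by the same averaging estimate as the functions. Compact support of η
supplies the domination. -/
lemma pd_convolution {η v : ℝ × ℝ → ℝ} (hη : ContDiff ℝ ∞ η) (hc : HasCompactSupport η)
    (hv : ContDiff ℝ 1 v) (j : Fin 2) (x : ℝ × ℝ) :
    pd j (η ⋆[ContinuousLinearMap.lsmul ℝ ℝ, volume] v) x =
      (η ⋆[ContinuousLinearMap.lsmul ℝ ℝ, volume] (pd j v)) x := by
  have hηc := hη.continuous
  have hfc : Continuous (fderiv ℝ v) := hv.continuous_fderiv (by norm_num)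
  obtain ⟨M, hM⟩ : ∃ M, ∀ y ∈ tsupport η, ∀ z ∈ Metric.closedBall x 1, ‖fderiv ℝ v (z - y)‖ ≤ M := by
    obtain ⟨M, hM⟩ := (hc.isCompact.prod (isCompact_closedBall x 1)).exists_bound_of_continuousOn
      (f := fun q : (ℝ × ℝ) × (ℝ × ℝ) => fderiv ℝ v (q.2 - q.1))
      (hfc.comp (continuous_snd.sub continuous_fst)).continuousOn
    exact ⟨M, fun y hy z hz => hM (y, z) ⟨hy, hz⟩⟩
  have hF : ∀ z, Continuous fun y => η y • v (z - y) := fun z =>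
    hηc.smul (hv.continuous.comp (continuous_const.sub continuous_id))
  have hF' : Continuous fun y => η y • fderiv ℝ v (x - y) :=
    hηc.smul (hfc.comp (continuous_const.sub continuous_id))
  have hder : HasFDerivAt (fun z => ∫ y, η y • v (z - y)) (∫ y, η y • fderiv ℝ v (x - y)) x := by
    refine hasFDerivAt_integral_of_dominated_of_fderiv_le (s := Metric.ball x 1)
      (bound := fun y => |η y| * M) (F' := fun z y => η y • fderiv ℝ v (z - y))
      (Metric.ball_mem_nhds x one_pos)
      (Filter.Eventually.of_forall fun z => (hF z).aestronglyMeasurable)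
      ((hF x).integrable_of_hasCompactSupport hc.smul_right) hF'.aestronglyMeasurable
      (Filter.Eventually.of_forall fun y z hz => ?_)
      ((hηc.abs.integrable_of_hasCompactSupport hc.abs).mul_const M)
      (Filter.Eventually.of_forall fun y z _ => ?_)
    · rw [norm_smul, Real.norm_eq_abs]
      by_cases hy : y ∈ tsupport η
      · exact mul_le_mul_of_nonneg_left (hM y hy z (Metric.ball_subset_closedBall hz)) (abs_nonneg _)
      · simp [image_eq_zero_of_notMem_tsupport hy]
    · have h1 := ((hv.differentiable (by norm_num)) (z - y)).hasFDerivAt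
      have h2 := h1.comp z ((hasFDerivAt_id z).sub_const y)
      exact h2.const_smul (η y)
  have hi : Integrable (fun y => η y • fderiv ℝ v (x - y)) :=
    hF'.integrable_of_hasCompactSupport hc.smul_right
  have e : (η ⋆[ContinuousLinearMap.lsmul ℝ ℝ, volume] v) = fun z => ∫ y, η y • v (z - y) := by
    funext z
    rfl
  rw [e]
  simp only [pd]
  rw [hder.fderiv, ContinuousLinearMap.integral_apply hi]
  rfl

/-- Smooth functions, periodic in the closed strip, are dense in the `C¹` sense. -/
lemma exists_smooth_approx (hε : 0 < ε) (hw : ContDiff ℝ 1 w)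
    (hper : ∀ s, ∀ t ∈ Set.Icc (-(ε / 2)) (ε / 2), w (s + 1, t) = w (s, t)) {δ : ℝ} (hδ : 0 < δ) :
    ∃ φ : ℝ × ℝ → ℝ, ContDiff ℝ ∞ φ ∧
      (∀ s, ∀ t ∈ Set.Icc (-(ε / 2)) (ε / 2), φ (s + 1, t) = φ (s, t)) ∧
      ∀ s ∈ Set.Icc (0 : ℝ) 1, ∀ t ∈ Set.Icc (-(ε / 2)) (ε / 2),
        |φ (s, t) - w (s, t)| ≤ δ ∧ ∀ j, |pd j φ (s, t) - pd j w (s, t)| ≤ δ := by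
  set K : Set (ℝ × ℝ) := Set.Icc (-1) 2 ×ˢ Set.Icc (-ε) ε with hK
  have hKc : IsCompact K := isCompact_Icc.prod isCompact_Icc
  have huc : ∀ f : ℝ × ℝ → ℝ, Continuous f → ∃ ρ > 0, ∀ x ∈ K, ∀ y ∈ K, dist x y < ρ →
      dist (f x) (f y) < δ / 2 := fun f hf =>
    Metric.uniformContinuousOn_iff.1 (hKc.uniformContinuousOn_of_continuous hf.continuousOn) _
      (by positivity)
  obtain ⟨ρ₀, hρ₀, H₀⟩ := huc w hw.continuous
  obtain ⟨ρ₁, hρ₁, H₁⟩ := huc _ (continuous_pd hw 0)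
  obtain ⟨ρ₂, hρ₂, H₂⟩ := huc _ (continuous_pd hw 1)
  obtain ⟨M, hM⟩ := hKc.exists_bound_of_continuousOn (continuous_pd hw 1).continuousOn
  set ρ := min ρ₀ (min ρ₁ ρ₂) with hρdef
  have hρ : 0 < ρ := lt_min hρ₀ (lt_min hρ₁ hρ₂)
  -- θ is a vertical compression. The first smallness condition keeps the compressed points within
  -- the modulus of continuity ρ; the second absorbs the factor 1 - θ that appears in the vertical
  -- derivative.
  obtain ⟨θ, hθ0, hθ1, hθε, hθM⟩ : ∃ θ : ℝ, 0 < θ ∧ θ ≤ 1 / 2 ∧ θ * (2 * ε + 1) < ρ ∧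
      θ * M ≤ δ / 2 := by
    refine ⟨min (1 / 2) (min (ρ / (2 * (2 * ε + 1))) (δ / (2 * (|M| + 1)))), by positivity,
      min_le_left _ _, ?_, ?_⟩
    · have h1 : min (1 / 2) (min (ρ / (2 * (2 * ε + 1))) (δ / (2 * (|M| + 1)))) ≤
          ρ / (2 * (2 * ε + 1)) := (min_le_right _ _).trans (min_le_left _ _)
      calc _ ≤ ρ / (2 * (2 * ε + 1)) * (2 * ε + 1) := by gcongr
        _ = ρ / 2 := by field_simp
        _ < ρ := by linarith
    · have h1 : min (1 / 2) (min (ρ / (2 * (2 * ε + 1))) (δ / (2 * (|M| + 1)))) ≤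
          δ / (2 * (|M| + 1)) := (min_le_right _ _).trans (min_le_right _ _)
      have h0 : (0 : ℝ) ≤ min (1 / 2) (min (ρ / (2 * (2 * ε + 1))) (δ / (2 * (|M| + 1)))) := by
        positivity
      calc _ ≤ min (1 / 2) (min (ρ / (2 * (2 * ε + 1))) (δ / (2 * (|M| + 1)))) * (|M| + 1) := by
              gcongr
              linarith [le_abs_self M]
        _ ≤ δ / (2 * (|M| + 1)) * (|M| + 1) := by gcongr
        _ = δ / 2 := by field_simp
  have hθε0 : 0 < θ * ε := by positivity
  obtain ⟨r, hr0, hr1, hrε, hrθ⟩ : ∃ r : ℝ, 0 < r ∧ r ≤ 1 ∧ r ≤ θ * ε / 2 ∧ r ≤ θ :=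
    ⟨min 1 (min (θ * ε / 2) θ), by positivity, min_le_left _ _,
      (min_le_right _ _).trans (min_le_left _ _), (min_le_right _ _).trans (min_le_right _ _)⟩
  -- Compressing before mollifying makes averages centred in the closed strip read `w` only inside
  -- that strip, where its periodicity is assumed.
  set v : ℝ × ℝ → ℝ := fun x => w (x.1, (1 - θ) * x.2) with hv
  have hvs : ContDiff ℝ 1 v := hw.comp (contDiff_fst.prodMk (contDiff_const.mul contDiff_snd))
  have hvd : Differentiable ℝ v := hvs.differentiable (by norm_num)
  have hwd : Differentiable ℝ w := hw.differentiable (by norm_num)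
  have pv0 : ∀ x, pd 0 v x = pd 0 w (x.1, (1 - θ) * x.2) := fun x =>
    pd_fst_eq (hvd x) (hasDerivAt_fst (x := (x.1, (1 - θ) * x.2)) (hwd _))
  have pv1 : ∀ x, pd 1 v x = (1 - θ) * pd 1 w (x.1, (1 - θ) * x.2) := fun x => by
    refine pd_snd_eq (hvd x) ?_
    have h1 := hasDerivAt_snd (x := (x.1, (1 - θ) * x.2)) (hwd _)
    have h2 := (hasDerivAt_id x.2).const_mul (1 - θ)
    exact (h1.comp x.2 h2).congr_deriv (by simp [mul_comm])
  let b : ContDiffBump (0 : ℝ × ℝ) := ⟨r / 2, r, by positivity, by linarith⟩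
  set η := b.normed volume with hη
  have hηs : ContDiff ℝ ∞ η := b.contDiff_normed
  have hηc : HasCompactSupport η := b.hasCompactSupport_normed
  have hsupp : Function.support η ⊆ Metric.ball 0 r := b.support_normed_eq.subset
  have near : ∀ s ∈ Set.Icc (0 : ℝ) 1, ∀ t ∈ Set.Icc (-(ε / 2)) (ε / 2),
      ∀ y ∈ Metric.ball ((s, t) : ℝ × ℝ) r,
        (y.1, (1 - θ) * y.2) ∈ K ∧ ((s, t) : ℝ × ℝ) ∈ K ∧
          dist ((y.1, (1 - θ) * y.2) : ℝ × ℝ) (s, t) < ρ := by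
    intro s hs t ht y hy
    rw [Metric.mem_ball, Prod.dist_eq, max_lt_iff, Real.dist_eq, Real.dist_eq, abs_lt, abs_lt] at hy
    obtain ⟨⟨a1, a2⟩, a3, a4⟩ := hy
    simp only at a1 a2 a3 a4
    obtain ⟨hs0, hs1⟩ := hs
    obtain ⟨ht0, ht1⟩ := ht
    have hrε' : r ≤ ε / 4 := by nlinarith
    have y2 : |y.2| ≤ ε := by rw [abs_le]; constructor <;> linarith
    have y2' := abs_le.1 y2
    have hy2 : |θ * y.2| ≤ θ * ε := by rw [abs_mul, abs_of_pos hθ0]; gcongr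
    have hy2' := abs_le.1 hy2
    have hz : |(1 - θ) * y.2| ≤ ε := by
      rw [abs_mul, abs_of_nonneg (by linarith)]
      exact (mul_le_of_le_one_left (abs_nonneg _) (by linarith)).trans y2
    refine ⟨⟨⟨by linarith, by linarith⟩, abs_le.1 hz⟩,
      ⟨⟨by linarith, by linarith⟩, by linarith, by linarith⟩, ?_⟩
    rw [Prod.dist_eq, max_lt_iff, Real.dist_eq, Real.dist_eq, abs_lt, abs_lt]
    simp only
    refine ⟨⟨by linarith, by linarith⟩, by linarith, by linarith⟩
  refine ⟨η ⋆[ContinuousLinearMap.lsmul ℝ ℝ, volume] v,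
    hηc.contDiff_convolution_left _ hηs hvs.continuous.locallyIntegrable, ?_, ?_⟩
  · intro s t ht
    rw [convolution_def, convolution_def]
    refine integral_congr_ae (Filter.Eventually.of_forall fun y => ?_)
    simp only [ContinuousLinearMap.lsmul_apply]
    by_cases hy : y ∈ Function.support η
    · congr 1
      have hy' := hsupp hy
      rw [Metric.mem_ball, Prod.dist_eq, max_lt_iff, Real.dist_eq, Real.dist_eq] at hy'
      have h2 := abs_lt.1 hy'.2
      simp only [Prod.snd_zero, sub_zero] at h2
      simp only [hv, Prod.fst_sub, Prod.snd_sub]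
      rw [add_sub_right_comm]
      -- With radius at most θε/2, the height is at most (1 - θ)(1 + θ) ε/2 ≤ ε/2 in absolute value.
      refine hper _ _ ⟨?_, ?_⟩ <;> nlinarith [ht.1, ht.2]
    · rw [Function.notMem_support.1 hy, zero_smul, zero_smul]
  · intro s hs t ht
    refine ⟨?_, fun j => ?_⟩
    · rw [← Real.dist_eq]
      refine dist_convolution_le hδ.le hsupp b.nonneg_normed b.integral_normed
        hvs.continuous.aestronglyMeasurable fun y hy => ?_
      obtain ⟨k1, k2, k3⟩ := near s hs t ht y hy
      have := H₀ _ k1 _ k2 (k3.trans_le (min_le_left _ _))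
      simp only [hv]
      linarith
    · rw [pd_convolution hηs hηc hvs, ← Real.dist_eq]
      refine dist_convolution_le hδ.le hsupp b.nonneg_normed b.integral_normed
        (continuous_pd hvs j).aestronglyMeasurable fun y hy => ?_
      obtain ⟨k1, k2, k3⟩ := near s hs t ht y hy
      fin_cases j
      · have := H₁ _ k1 _ k2 (k3.trans_le ((min_le_right _ _).trans (min_le_left _ _)))
        simp only [Fin.zero_eta, pv0]
        linarith
      · have := H₂ _ k1 _ k2 (k3.trans_le ((min_le_right _ _).trans (min_le_right _ _)))
        have hb := hM _ k1
        simp only [Fin.mk_one, pv1]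
        rw [Real.dist_eq] at this ⊢
        rw [Real.norm_eq_abs] at hb
        calc _ = |(pd 1 w (y.1, (1 - θ) * y.2) - pd 1 w (s, t)) - θ * pd 1 w (y.1, (1 - θ) * y.2)| := by
              congr 1; ring
          _ ≤ |pd 1 w (y.1, (1 - θ) * y.2) - pd 1 w (s, t)| + |θ * pd 1 w (y.1, (1 - θ) * y.2)| :=
              abs_sub _ _
          _ ≤ δ / 2 + θ * M := by
              rw [abs_mul, abs_of_pos hθ0]
              gcongr
          _ ≤ δ := by linarith

/-- `C¹` functions that are periodic in the closed strip and vanish on its horizontal boundary. -/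
lemma memHPer10_of_contDiff (hε : 0 < ε) (hw : ContDiff ℝ 1 w)
    (hper : ∀ s, ∀ t ∈ Set.Icc (-(ε / 2)) (ε / 2), w (s + 1, t) = w (s, t))
    (top : ∀ s, w (s, ε / 2) = 0) (bot : ∀ s, w (s, -(ε / 2)) = 0) :
    MemHPer10 ε w (fun j => pd j w) where
  memLp := memLp_of_continuous hw.continuous
  memLp_grad j := memLp_of_continuous (continuous_pd hw j)
  approx δ hδ := by
    obtain ⟨d, hd0, hd⟩ : ∃ d : ℝ, 0 < d ∧
        (vol (strip ε) Set.univ) ^ (2 : ℝ≥0∞).toReal⁻¹ * ENNReal.ofReal d < δ := by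
      have hfin : (vol (strip ε) Set.univ) ^ (2 : ℝ≥0∞).toReal⁻¹ ≠ ⊤ :=
        ENNReal.rpow_ne_top_of_nonneg (by positivity) (measure_ne_top _ _)
      have ht : Filter.Tendsto (fun d : ℝ => (vol (strip ε) Set.univ) ^ (2 : ℝ≥0∞).toReal⁻¹ *
          ENNReal.ofReal d) (nhdsWithin 0 (Set.Ioi 0)) (nhds 0) := by
        have h1 : Filter.Tendsto (fun d : ℝ => ENNReal.ofReal d) (nhdsWithin 0 (Set.Ioi 0))
            (nhds 0) := by
          have := (ENNReal.continuous_ofReal.tendsto 0).mono_left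
            (nhdsWithin_le_nhds (s := Set.Ioi (0 : ℝ)))
          simpa using this
        have := ENNReal.Tendsto.const_mul h1 (Or.inr hfin)
        simpa using this
      obtain ⟨d, h1, h2⟩ := ((ht.eventually_lt_const hδ).and self_mem_nhdsWithin).exists
      exact ⟨d, h2, h1⟩
    -- The boundary correction below has a vertical derivative of size up to 2c/ε, so the C¹
    -- accuracy c must satisfy c + 2c/ε ≤ d as well as 2c ≤ d.
    have hd' : 0 < d * ε / (3 * (ε + 1)) := by positivity
    obtain ⟨φ, hφs, hφp, hφ⟩ := exists_smooth_approx hε hw hper hd'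
    set c := d * ε / (3 * (ε + 1)) with hc
    have hcd : 3 * c ≤ d := by
      rw [hc]
      have : d * ε / (3 * (ε + 1)) * (3 * (ε + 1)) = d * ε := by field_simp
      nlinarith
    have hcd' : c + 2 * c / ε ≤ d := by
      have h1 : c / ε = d / (3 * (ε + 1)) := by rw [hc]; field_simp
      have h2 : d / (3 * (ε + 1)) ≤ d / 3 := by
        apply div_le_div_of_nonneg_left hd0.le (by norm_num); linarith
      have : 2 * c / ε = 2 * (c / ε) := by ring
      rw [this, h1]; linarith
    have hφd : Differentiable ℝ φ := hφs.differentiable (by simp)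
    -- `A + B` interpolates the two wall traces of φ linearly in x₂. Subtracting it restores the
    -- zero boundary values and keeps smoothness and periodicity.
    set A : ℝ × ℝ → ℝ := fun x => (1 / 2 + x.2 / ε) * φ (x.1, ε / 2) with hA
    set B : ℝ × ℝ → ℝ := fun x => (1 / 2 - x.2 / ε) * φ (x.1, -(ε / 2)) with hB
    have hAs : ContDiff ℝ ∞ A := (contDiff_const.add (contDiff_snd.div_const ε)).mul
      (hφs.comp (contDiff_fst.prodMk contDiff_const))
    have hBs : ContDiff ℝ ∞ B := (contDiff_const.sub (contDiff_snd.div_const ε)).mul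
      (hφs.comp (contDiff_fst.prodMk contDiff_const))
    have hAd : Differentiable ℝ A := hAs.differentiable (by simp)
    have hBd : Differentiable ℝ B := hBs.differentiable (by simp)
    have tmem : ε / 2 ∈ Set.Icc (-(ε / 2)) (ε / 2) := ⟨by linarith, le_rfl⟩
    have bmem : -(ε / 2) ∈ Set.Icc (-(ε / 2)) (ε / 2) := ⟨le_rfl, by linarith⟩
    have hψ : IsPerSmooth ε (fun x => φ x - (A x + B x)) :=
      { smooth := hφs.sub (hAs.add hBs)
        periodic := fun s t ht => by
          simp only [hA, hB, hφp s t ht, hφp s _ tmem, hφp s _ bmem]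
        top := fun s => by
          simp only [hA, hB]; field_simp; ring
        bot := fun s => by
          simp only [hA, hB]; field_simp; ring }
    have pA0 : ∀ x, pd 0 A x = (1 / 2 + x.2 / ε) * pd 0 φ (x.1, ε / 2) := fun x =>
      pd_fst_eq (hAd x) ((hasDerivAt_fst (x := (x.1, ε / 2)) (hφd _)).const_mul (1 / 2 + x.2 / ε))
    have pB0 : ∀ x, pd 0 B x = (1 / 2 - x.2 / ε) * pd 0 φ (x.1, -(ε / 2)) := fun x =>
      pd_fst_eq (hBd x) ((hasDerivAt_fst (x := (x.1, -(ε / 2))) (hφd _)).const_mul (1 / 2 - x.2 / ε))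
    have pA1 : ∀ x, pd 1 A x = 1 / ε * φ (x.1, ε / 2) := fun x =>
      pd_snd_eq (hAd x) ((((hasDerivAt_id x.2).div_const ε).const_add (1 / 2)).mul_const (φ (x.1, ε / 2)))
    have pB1 : ∀ x, pd 1 B x = -(1 / ε) * φ (x.1, -(ε / 2)) := fun x =>
      pd_snd_eq (hBd x) ((((hasDerivAt_id x.2).div_const ε).const_sub (1 / 2)).mul_const (φ (x.1, -(ε / 2))))
    -- Tangential derivatives of `w` vanish on the walls, so those of the traces of φ are as small
    -- as the approximation error.
    have w0 : ∀ s, pd 0 w (s, ε / 2) = 0 := fun s =>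
      pd_fst_eq (hw.differentiable (by norm_num) _) (by
        simp only [top]; exact hasDerivAt_const _ _)
    have w0' : ∀ s, pd 0 w (s, -(ε / 2)) = 0 := fun s =>
      pd_fst_eq (hw.differentiable (by norm_num) _) (by
        simp only [bot]; exact hasDerivAt_const _ _)
    -- The interpolation weights are nonnegative and add up to one, so no constant is lost.
    have coef : ∀ t ∈ Set.Ioo (-(ε / 2)) (ε / 2), ∀ p q : ℝ, |p| ≤ c → |q| ≤ c →
        |(1 / 2 + t / ε) * p + (1 / 2 - t / ε) * q| ≤ c := by
      intro t ht p q hp hq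
      have h1 : 0 ≤ 1 / 2 + t / ε := by
        have : 1 / 2 + t / ε = (ε / 2 + t) / ε := by field_simp
        rw [this]; exact div_nonneg (by linarith [ht.1]) hε.le
      have h2 : 0 ≤ 1 / 2 - t / ε := by
        have : 1 / 2 - t / ε = (ε / 2 - t) / ε := by field_simp
        rw [this]; exact div_nonneg (by linarith [ht.2]) hε.le
      rw [abs_le] at hp hq ⊢
      constructor <;> nlinarith
    have bound : ∀ f : ℝ × ℝ → ℝ, (∀ x ∈ (strip ε : Set (ℝ × ℝ)), |f x| ≤ d) →
        eLpNorm f 2 (vol (strip ε)) < δ := by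
      intro f hf
      refine lt_of_le_of_lt (eLpNorm_le_of_ae_bound (C := d) ?_) hd
      exact (ae_restrict_iff' measurableSet_strip).2 (Filter.Eventually.of_forall hf)
    refine ⟨_, hψ, bound _ ?_, fun j => bound _ ?_⟩
    · rintro ⟨s, t⟩ ⟨hs, ht⟩
      have hs' : s ∈ Set.Icc (0 : ℝ) 1 := ⟨hs.1.le, hs.2.le⟩
      have h1 := (hφ s hs' t ⟨ht.1.le, ht.2.le⟩).1
      have h2 := (hφ s hs' _ tmem).1
      have h3 := (hφ s hs' _ bmem).1
      rw [top, sub_zero] at h2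
      rw [bot, sub_zero] at h3
      have h4 := coef t ht _ _ h2 h3
      simp only [Pi.sub_apply, hA, hB]
      rw [sub_right_comm]
      exact (abs_sub _ _).trans (by linarith)
    · rintro ⟨s, t⟩ ⟨hs, ht⟩
      have hs' : s ∈ Set.Icc (0 : ℝ) 1 := ⟨hs.1.le, hs.2.le⟩
      have h1 := (hφ s hs' t ⟨ht.1.le, ht.2.le⟩).2 j
      rw [Pi.sub_apply, pd_sub (w := fun x => A x + B x) (hφd _) ((hAd.add hBd) _), pd_add (hAd _) (hBd _), sub_right_comm]
      refine (abs_sub _ _).trans ?_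
      fin_cases j
      · have h2 := (hφ s hs' _ tmem).2 0
        have h3 := (hφ s hs' _ bmem).2 0
        rw [w0, sub_zero] at h2
        rw [w0', sub_zero] at h3
        have h4 := coef t ht _ _ h2 h3
        simp only [Fin.zero_eta, pA0, pB0] at h1 ⊢
        linarith
      · have h2 := (hφ s hs' _ tmem).1
        have h3 := (hφ s hs' _ bmem).1
        rw [top, sub_zero] at h2
        rw [bot, sub_zero] at h3
        simp only [Fin.mk_one, pA1, pB1] at h1 ⊢
        have h4 : |1 / ε * φ (s, ε / 2) + -(1 / ε) * φ (s, -(ε / 2))| ≤ 2 * c / ε := by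
          have : 1 / ε * φ (s, ε / 2) + -(1 / ε) * φ (s, -(ε / 2)) =
              (φ (s, ε / 2) - φ (s, -(ε / 2))) / ε := by ring
          rw [this, abs_div, abs_of_pos hε]
          gcongr
          exact (abs_sub _ _).trans (by linarith)
        linarith

end Density

/-! ### The energy estimate -/

section Energy

variable {ν f₁ : ℝ → ℝ} {ε : ℝ} {U u : Fin 2 → ℝ × ℝ → ℝ} {P : ℝ × ℝ → ℝ}
  {G : Fin 2 → Fin 2 → ℝ × ℝ → ℝ}

/-- The gradient of a classical vector field. -/
def jac (U : Fin 2 → ℝ × ℝ → ℝ) (i j : Fin 2) : ℝ × ℝ → ℝ := pd j (U i)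

/-- The viscous stress of a classical vector field. -/
def stress (ν : ℝ → ℝ) (U : Fin 2 → ℝ × ℝ → ℝ) (i j : Fin 2) (x : ℝ × ℝ) : ℝ :=
  ν x.1 * symGrad (jac U) i j x

/-- The residual of the momentum equation. -/
def residual (ν f₁ : ℝ → ℝ) (U : Fin 2 → ℝ × ℝ → ℝ) (P : ℝ × ℝ → ℝ) (i : Fin 2) (x : ℝ × ℝ) : ℝ :=
  -(∑ j, pd j (stress ν U i j) x) + pd i P x - force f₁ i x

/-- Classical divergence-free periodic fields with a periodic pressure. -/
structure IsClassicalPair (ε : ℝ) (U : Fin 2 → ℝ × ℝ → ℝ) (P : ℝ × ℝ → ℝ) : Prop where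
  smooth : ∀ i, ContDiff ℝ 2 (U i)
  smooth_pressure : ContDiff ℝ 1 P
  periodic : ∀ i s, ∀ t ∈ Set.Icc (-(ε / 2)) (ε / 2), U i (s + 1, t) = U i (s, t)
  sides : ∀ t ∈ Set.Ioo (-(ε / 2)) (ε / 2), P (1, t) = P (0, t)
  top : ∀ i s, U i (s, ε / 2) = 0
  bot : ∀ i s, U i (s, -(ε / 2)) = 0
  div_free : ∀ x ∈ (strip ε : Set (ℝ × ℝ)), pd 0 (U 0) x + pd 1 (U 1) x = 0

lemma continuous_force (hf : Continuous f₁) (i : Fin 2) : Continuous (force f₁ i) := by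
  fin_cases i
  · exact hf.comp continuous_fst
  · exact continuous_const

lemma contDiff_jac (hU : ∀ i, ContDiff ℝ 2 (U i)) (i j : Fin 2) : ContDiff ℝ 1 (jac U i j) :=
  contDiff_pd (hU i) (by norm_num) j

lemma contDiff_stress (hν : ContDiff ℝ 1 ν) (hU : ∀ i, ContDiff ℝ 2 (U i)) (i j : Fin 2) :
    ContDiff ℝ 1 (stress ν U i j) :=
  (hν.comp contDiff_fst).mul (((contDiff_jac hU i j).add (contDiff_jac hU j i)).div_const 2)

lemma continuous_residual (hν : ContDiff ℝ 1 ν) (hf : Continuous f₁) (h : IsClassicalPair ε U P)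
    (i : Fin 2) : Continuous (residual ν f₁ U P i) :=
  ((continuous_finsetSum _ fun j _ => continuous_pd (contDiff_stress hν h.smooth i j) j).neg.add
    (continuous_pd h.smooth_pressure i)).sub (continuous_force hf i)

lemma IsClassicalPair.memHPer10 (hε : 0 < ε) (h : IsClassicalPair ε U P) (i : Fin 2) :
    MemHPer10 ε (U i) (jac U i) :=
  memHPer10_of_contDiff hε ((h.smooth i).of_le (by norm_num)) (h.periodic i) (h.top i) (h.bot i)

lemma IsClassicalPair.stress_sides (hν : Function.Periodic ν 1) (h : IsClassicalPair ε U P)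
    (i j : Fin 2) {t : ℝ} (ht : t ∈ Set.Ioo (-(ε / 2)) (ε / 2)) :
    stress ν U i j (1, t) = stress ν U i j (0, t) := by
  have hj : ∀ i j, jac U i j (1, t) = jac U i j (0, t) := fun i j => by
    simpa [jac] using pd_periodic ((h.smooth i).differentiable (by norm_num)) (h.periodic i) j ht 0
  have h1 : ν 1 = ν 0 := by simpa using hν 0
  simp only [stress, symGrad, hj, h1]

/-- The weak form of the approximate momentum equation. -/
lemma IsClassicalPair.weak_form (hν : ContDiff ℝ 1 ν) (hν_per : Function.Periodic ν 1)
    (hf : Continuous f₁) (h : IsClassicalPair ε U P)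
    {w : Fin 2 → ℝ × ℝ → ℝ} {g : Fin 2 → Fin 2 → ℝ × ℝ → ℝ}
    (hw : ∀ i, MemLp (w i) 2 (vol (strip ε)))
    (hibp : ∀ i, IntegratesByParts ε (w i) (g i)) :
    (∑ i, ∑ j, ∫ x in (strip ε : Set (ℝ × ℝ)), stress ν U i j x * g i j x)
      - ∑ i, ∫ x in (strip ε : Set (ℝ × ℝ)), P x * g i i x =
    (∑ i, ∫ x in (strip ε : Set (ℝ × ℝ)), residual ν f₁ U P i x * w i x)
      + ∑ i, ∫ x in (strip ε : Set (ℝ × ℝ)), force f₁ i x * w i x := by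
  rw [← Finset.sum_sub_distrib, ← Finset.sum_add_distrib]
  refine Finset.sum_congr rfl fun i _ => ?_
  have hs := fun j => contDiff_stress hν h.smooth i j
  rw [hibp i P h.smooth_pressure h.sides i]
  simp_rw [fun j => hibp i _ (hs j) (fun t ht => h.stress_sides hν_per i j ht) j]
  have i₁ : ∀ j, Integrable (fun x => pd j (stress ν U i j) x * w i x) (vol (strip ε)) := fun j =>
    integrable_mul_of_memLp (memLp_of_continuous (continuous_pd (hs j) j)) (hw i)
  have i₂ : Integrable (fun x => pd i P x * w i x) (vol (strip ε)) :=
    integrable_mul_of_memLp (memLp_of_continuous (continuous_pd h.smooth_pressure i)) (hw i)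
  have i₃ : Integrable (fun x => residual ν f₁ U P i x * w i x) (vol (strip ε)) :=
    integrable_mul_of_memLp (memLp_of_continuous (continuous_residual hν hf h i)) (hw i)
  have i₄ : Integrable (fun x => force f₁ i x * w i x) (vol (strip ε)) :=
    integrable_mul_of_memLp (memLp_of_continuous (continuous_force hf i)) (hw i)
  rw [← integral_add i₃ i₄, Fin.sum_univ_two, sub_neg_eq_add, ← neg_add, ← integral_add (i₁ 0) (i₁ 1),
    ← integral_neg, ← integral_add ((i₁ 0).fun_add (i₁ 1)).fun_neg i₂]
  refine integral_congr_ae (Filter.Eventually.of_forall fun x => ?_)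
  simp only [residual, Fin.sum_univ_two]
  ring

/-- The square of the `L²` norm of a gradient. -/
def dirichlet (ε : ℝ) (W : Fin 2 → Fin 2 → ℝ × ℝ → ℝ) : ℝ :=
  ∑ i, ∑ j, ∫ x in (strip ε : Set (ℝ × ℝ)), W i j x ^ 2

lemma dirichlet_nonneg (W : Fin 2 → Fin 2 → ℝ × ℝ → ℝ) : 0 ≤ dirichlet ε W :=
  Finset.sum_nonneg fun _ _ => Finset.sum_nonneg fun _ _ => integral_nonneg fun _ => sq_nonneg _

lemma integral_sq_le_dirichlet (W : Fin 2 → Fin 2 → ℝ × ℝ → ℝ) (i j : Fin 2) :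
    ∫ x in (strip ε : Set (ℝ × ℝ)), W i j x ^ 2 ≤ dirichlet ε W := by
  have h : ∀ i j, 0 ≤ ∫ x in (strip ε : Set (ℝ × ℝ)), W i j x ^ 2 := fun i j =>
    integral_nonneg fun x => sq_nonneg _
  exact (Finset.single_le_sum (f := fun j => ∫ x in (strip ε : Set (ℝ × ℝ)), W i j x ^ 2)
    (fun j _ => h i j) (Finset.mem_univ j)).trans
    (Finset.single_le_sum (f := fun i => ∑ j, ∫ x in (strip ε : Set (ℝ × ℝ)), W i j x ^ 2)
      (fun i _ => Finset.sum_nonneg fun j _ => h i j) (Finset.mem_univ i))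

lemma memLp_symGrad {W : Fin 2 → Fin 2 → ℝ × ℝ → ℝ} (hW : ∀ i j, MemLp (W i j) 2 (vol (strip ε)))
    (i j : Fin 2) : MemLp (symGrad W i j) 2 (vol (strip ε)) := by
  have := ((hW i j).add (hW j i)).const_mul (1 / 2)
  convert this using 1
  funext x
  simp only [symGrad, Pi.add_apply]
  ring

lemma integral_symGrad_sq_le {W : Fin 2 → Fin 2 → ℝ × ℝ → ℝ}
    (hW : ∀ i j, MemLp (W i j) 2 (vol (strip ε))) (i j : Fin 2) :
    ∫ x in (strip ε : Set (ℝ × ℝ)), symGrad W i j x ^ 2 ≤ dirichlet ε W := by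
  have i₁ := (integrable_sq_of_memLp (hW i j)).const_mul (1 / 2)
  have i₂ := (integrable_sq_of_memLp (hW j i)).const_mul (1 / 2)
  have h1 : ∫ x in (strip ε : Set (ℝ × ℝ)), symGrad W i j x ^ 2 ≤
      ∫ x in (strip ε : Set (ℝ × ℝ)), (1 / 2 * W i j x ^ 2 + 1 / 2 * W j i x ^ 2) := by
    refine integral_mono (integrable_sq_of_memLp (memLp_symGrad hW i j)) (i₁.add i₂) fun x => ?_
    simp only [symGrad]
    nlinarith [sq_nonneg (W i j x - W j i x)]
  rw [integral_add i₁ i₂, integral_const_mul, integral_const_mul] at h1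
  linarith [integral_sq_le_dirichlet (ε := ε) W i j, integral_sq_le_dirichlet (ε := ε) W j i]

/-- The Korn inequality. -/
lemma dirichlet_le_symGrad (hε : 0 < ε) {w : Fin 2 → ℝ × ℝ → ℝ} {W : Fin 2 → Fin 2 → ℝ × ℝ → ℝ}
    (h : ∀ i, MemHPer10 ε (w i) (W i)) :
    dirichlet ε W ≤ 2 * ∫ x in (strip ε : Set (ℝ × ℝ)), ∑ i, ∑ j, symGrad W i j x * symGrad W i j x := by
  have hW : ∀ i j, MemLp (W i j) 2 (vol (strip ε)) := fun i => (h i).memLp_grad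
  have isq : ∀ i j, Integrable (fun x => W i j x ^ 2) (vol (strip ε)) := fun i j =>
    integrable_sq_of_memLp (hW i j)
  -- The cross term ∫ ∂₂w₁ ∂₁w₂ is replaced by ∫ ∂₁w₁ ∂₂w₂; then twice the symmetric energy minus
  -- the Dirichlet energy equals ∫ (div w)² ≥ 0.
  have null := (h 0).integral_mul_comm hε (h 1)
  have nn : 0 ≤ ∫ x in (strip ε : Set (ℝ × ℝ)), (W 0 0 x + W 1 1 x) ^ 2 :=
    integral_nonneg fun x => sq_nonneg _
  have e₁ : ∫ x in (strip ε : Set (ℝ × ℝ)), (W 0 0 x + W 1 1 x) ^ 2 =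
      (∫ x in (strip ε : Set (ℝ × ℝ)), W 0 0 x ^ 2) + (∫ x in (strip ε : Set (ℝ × ℝ)), W 1 1 x ^ 2)
        + 2 * ∫ x in (strip ε : Set (ℝ × ℝ)), W 0 0 x * W 1 1 x := by
    rw [← integral_const_mul, ← integral_add (isq 0 0) (isq 1 1), ← integral_add
      ((isq 0 0).fun_add (isq 1 1)) ((integrable_mul_of_memLp (hW 0 0) (hW 1 1)).const_mul 2)]
    refine integral_congr_ae (Filter.Eventually.of_forall fun x => ?_)
    ring
  have e₂ : 2 * ∫ x in (strip ε : Set (ℝ × ℝ)), ∑ i, ∑ j, symGrad W i j x * symGrad W i j x =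
      2 * (∫ x in (strip ε : Set (ℝ × ℝ)), W 0 0 x ^ 2)
        + 2 * (∫ x in (strip ε : Set (ℝ × ℝ)), W 1 1 x ^ 2)
        + ((∫ x in (strip ε : Set (ℝ × ℝ)), W 0 1 x ^ 2)
        + ((∫ x in (strip ε : Set (ℝ × ℝ)), W 1 0 x ^ 2)
        + 2 * ∫ x in (strip ε : Set (ℝ × ℝ)), W 0 1 x * W 1 0 x)) := by
    have j₁ := (isq 0 0).const_mul 2
    have j₂ := (isq 1 1).const_mul 2
    have j₃ := (integrable_mul_of_memLp (hW 0 1) (hW 1 0)).const_mul 2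
    rw [← integral_const_mul, ← integral_const_mul, ← integral_const_mul, ← integral_const_mul,
      ← integral_add (isq 1 0) j₃, ← integral_add (isq 0 1) ((isq 1 0).fun_add j₃),
      ← integral_add j₁ j₂, ← integral_add (j₁.fun_add j₂) ((isq 0 1).fun_add ((isq 1 0).fun_add j₃))]
    refine integral_congr_ae (Filter.Eventually.of_forall fun x => ?_)
    simp only [symGrad, Fin.sum_univ_two]
    ring
  rw [e₂, dirichlet]
  simp only [Fin.sum_univ_two]
  linarith

/-- The strip has area ε; this is the source of the half power in the final rate. -/
lemma sqrt_integral_sq_le_of_bound (hε : 0 < ε) {f : ℝ × ℝ → ℝ} (hf : Continuous f) {B : ℝ} (hB : 0 ≤ B)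
    (h : ∀ x ∈ (strip ε : Set (ℝ × ℝ)), |f x| ≤ B) :
    √(∫ x in (strip ε : Set (ℝ × ℝ)), f x ^ 2) ≤ B * √ε := by
  rw [← Real.sqrt_sq hB, ← Real.sqrt_mul (sq_nonneg B)]
  refine Real.sqrt_le_sqrt ?_
  have h1 : ∫ x in (strip ε : Set (ℝ × ℝ)), f x ^ 2 ≤ ∫ _ in (strip ε : Set (ℝ × ℝ)), B ^ 2 :=
    setIntegral_mono_on (integrable_sq_of_memLp (memLp_of_continuous hf)) (integrable_const _)
      measurableSet_strip fun x hx => sq_le_sq' (abs_le.1 (h x hx)).1 (abs_le.1 (h x hx)).2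
  refine h1.trans_eq ?_
  rw [setIntegral_const, Measure.real, volume_strip, ENNReal.toReal_ofReal hε.le, smul_eq_mul,
    mul_comm]

/-- A bounded function against a function satisfying the Poincaré inequality. -/
lemma abs_integral_mul_le_of_poincare (hε : 0 < ε) {f w g : ℝ × ℝ → ℝ} (hf : Continuous f) {B E : ℝ}
    (hB : 0 ≤ B) (h : ∀ x ∈ (strip ε : Set (ℝ × ℝ)), |f x| ≤ B) (hw : MemLp w 2 (vol (strip ε)))
    (hp : ∫ x in (strip ε : Set (ℝ × ℝ)), w x ^ 2 ≤ ε ^ 2 * ∫ x in (strip ε : Set (ℝ × ℝ)), g x ^ 2)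
    (hE : ∫ x in (strip ε : Set (ℝ × ℝ)), g x ^ 2 ≤ E) :
    |∫ x in (strip ε : Set (ℝ × ℝ)), f x * w x| ≤ B * (ε * √ε) * √E := by
  have h1 : √(∫ x in (strip ε : Set (ℝ × ℝ)), w x ^ 2) ≤ ε * √E := by
    rw [← Real.sqrt_sq hε.le, ← Real.sqrt_mul (sq_nonneg ε), Real.sqrt_sq hε.le]
    exact Real.sqrt_le_sqrt (hp.trans (by gcongr))
  calc _ ≤ √(∫ x in (strip ε : Set (ℝ × ℝ)), f x ^ 2) * √(∫ x in (strip ε : Set (ℝ × ℝ)), w x ^ 2) :=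
        abs_integral_mul_le (memLp_of_continuous hf) hw
    _ ≤ (B * √ε) * (ε * √E) := by
        gcongr
        exact sqrt_integral_sq_le_of_bound hε hf hB h
    _ = B * (ε * √ε) * √E := by ring

/-- The gradient of the error is controlled by the residual. -/
theorem sqrt_dirichlet_error_le {κ B : ℝ} (hκ : 0 < κ) (hB : 0 ≤ B) (hε : 0 < ε)
    (hν : ContDiff ℝ 1 ν) (hν_per : Function.Periodic ν 1)
    (hν_pos : ∀ s ∈ Set.Ioo (0 : ℝ) 1, κ ≤ ν s) (hf : Continuous f₁)
    (h : IsClassicalPair ε U P)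
    (hres : ∀ i, ∀ x ∈ (strip ε : Set (ℝ × ℝ)), |residual ν f₁ U P i x| ≤ B)
    (hu : IsWeakSolution ν f₁ ε u G) :
    √(dirichlet ε (fun i j => jac U i j - G i j)) ≤ 4 / κ * (B * (ε * √ε)) := by
  set W : Fin 2 → Fin 2 → ℝ × ℝ → ℝ := fun i j => jac U i j - G i j with hWdef
  have hper : ∀ i, MemHPer10 ε (U i - u i) (W i) := fun i =>
    (h.memHPer10 hε i).sub (hu.mem.comp i)
  have hdiv : ∀ᵐ x ∂(vol (strip ε)), W 0 0 x + W 1 1 x = 0 := by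
    have h1 : ∀ᵐ x ∂(vol (strip ε)), pd 0 (U 0) x + pd 1 (U 1) x = 0 :=
      (ae_restrict_iff' measurableSet_strip).2 (Filter.Eventually.of_forall h.div_free)
    filter_upwards [h1, hu.mem.div_free] with x h1 h2
    simp only [hWdef, jac, Pi.sub_apply]
    linarith
  have hW : ∀ i j, MemLp (W i j) 2 (vol (strip ε)) := fun i => (hper i).memLp_grad
  have hG : ∀ i j, MemLp (G i j) 2 (vol (strip ε)) := fun i => (hu.mem.comp i).memLp_grad
  have hJ : ∀ i j, MemLp (jac U i j) 2 (vol (strip ε)) := fun i => (h.memHPer10 hε i).memLp_grad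
  have hνc : Continuous fun x : ℝ × ℝ => ν x.1 := hν.continuous.comp continuous_fst
  -- The error is itself an admissible divergence-free test field.
  have hweak := hu.weak _ W ⟨hper, hdiv⟩
  have hcl := h.weak_form hν hν_per hf (fun i => (hper i).memLp)
    (fun i => (hper i).integratesByParts hε)
  have hpress : ∑ i, ∫ x in (strip ε : Set (ℝ × ℝ)), P x * W i i x = 0 := by
    rw [Fin.sum_univ_two, ← integral_add
      (integrable_mul_of_memLp (memLp_of_continuous h.smooth_pressure.continuous) (hW 0 0))
      (integrable_mul_of_memLp (memLp_of_continuous h.smooth_pressure.continuous) (hW 1 1))]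
    refine integral_eq_zero_of_ae ?_
    filter_upwards [hdiv] with x hx
    rw [← mul_add, hx, mul_zero]
    rfl
  have hforce : ∫ x in (strip ε : Set (ℝ × ℝ)), ∑ i, force f₁ i x * (U i - u i) x =
      ∑ i, ∫ x in (strip ε : Set (ℝ × ℝ)), force f₁ i x * (U i - u i) x :=
    integral_finsetSum _ fun i _ =>
      integrable_mul_of_memLp (memLp_of_continuous (continuous_force hf i)) (hper i).memLp
  have iS : ∀ V V' : Fin 2 → Fin 2 → ℝ × ℝ → ℝ, (∀ i j, MemLp (V i j) 2 (vol (strip ε))) →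
      (∀ i j, MemLp (V' i j) 2 (vol (strip ε))) →
      Integrable (fun x => ν x.1 * ∑ i, ∑ j, symGrad V i j x * symGrad V' i j x)
        (vol (strip ε)) := by
    intro V V' hV hV'
    simp_rw [Finset.mul_sum, ← mul_assoc]
    refine integrable_finsetSum _ fun i _ => integrable_finsetSum _ fun j _ => ?_
    exact integrable_mul_of_memLp (memLp_mul_of_continuous hνc (memLp_symGrad hV i j))
      (memLp_symGrad hV' i j)
  -- The stress is symmetric, so pairing it with the full gradient or with its symmetric part gives
  -- the same value.
  have hstress : ∫ x in (strip ε : Set (ℝ × ℝ)),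
      ν x.1 * ∑ i, ∑ j, symGrad (jac U) i j x * symGrad W i j x =
      ∑ i, ∑ j, ∫ x in (strip ε : Set (ℝ × ℝ)), stress ν U i j x * W i j x := by
    have hi : ∀ i j, Integrable (fun x => stress ν U i j x * W i j x) (vol (strip ε)) := fun i j =>
      integrable_mul_of_memLp (memLp_of_continuous (contDiff_stress hν h.smooth i j).continuous)
        (hW i j)
    simp_rw [← integral_finsetSum Finset.univ fun j _ => hi _ j]
    rw [← integral_finsetSum Finset.univ fun i _ => integrable_finsetSum _ fun j _ => hi i j]
    refine integral_congr_ae (Filter.Eventually.of_forall fun x => ?_)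
    simp only [stress, symGrad, Fin.sum_univ_two]
    ring
  have hsplit : ∫ x in (strip ε : Set (ℝ × ℝ)), ν x.1 * ∑ i, ∑ j, symGrad W i j x * symGrad W i j x =
      ∑ i, ∫ x in (strip ε : Set (ℝ × ℝ)), residual ν f₁ U P i x * (U i - u i) x := by
    have h1 : ∫ x in (strip ε : Set (ℝ × ℝ)), ν x.1 * ∑ i, ∑ j, symGrad W i j x * symGrad W i j x =
        (∫ x in (strip ε : Set (ℝ × ℝ)), ν x.1 * ∑ i, ∑ j, symGrad (jac U) i j x * symGrad W i j x) -
        ∫ x in (strip ε : Set (ℝ × ℝ)), ν x.1 * ∑ i, ∑ j, symGrad G i j x * symGrad W i j x := by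
      rw [← integral_sub (iS _ _ hJ hW) (iS _ _ hG hW)]
      refine integral_congr_ae (Filter.Eventually.of_forall fun x => ?_)
      simp only [symGrad, Fin.sum_univ_two, hWdef, Pi.sub_apply]
      ring
    rw [h1, hweak, hstress, hforce]
    linarith
  have hcoer : κ * ∫ x in (strip ε : Set (ℝ × ℝ)), ∑ i, ∑ j, symGrad W i j x * symGrad W i j x ≤
      ∫ x in (strip ε : Set (ℝ × ℝ)), ν x.1 * ∑ i, ∑ j, symGrad W i j x * symGrad W i j x := by
    rw [← integral_const_mul]
    refine setIntegral_mono_on ?_ (iS _ _ hW hW) measurableSet_strip fun x hx => ?_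
    · refine Integrable.const_mul ?_ κ
      exact integrable_finsetSum _ fun i _ => integrable_finsetSum _ fun j _ =>
        integrable_mul_of_memLp (memLp_symGrad hW i j) (memLp_symGrad hW i j)
    · exact mul_le_mul_of_nonneg_right (hν_pos x.1 hx.1)
        (Finset.sum_nonneg fun _ _ => Finset.sum_nonneg fun _ _ => mul_self_nonneg _)
  have hkorn := dirichlet_le_symGrad hε hper
  set E := dirichlet ε W with hE
  have hE0 : 0 ≤ E := dirichlet_nonneg W
  have hR : ∀ i, |∫ x in (strip ε : Set (ℝ × ℝ)), residual ν f₁ U P i x * (U i - u i) x| ≤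
      B * (ε * √ε) * √E := fun i =>
    abs_integral_mul_le_of_poincare hε (continuous_residual hν hf h i) hB (hres i) (hper i).memLp
      ((hper i).integral_sq_le hε) (integral_sq_le_dirichlet W i 1)
  -- Coercivity and Korn on the left; on the right, one Cauchy–Schwarz and Poincaré bound for each
  -- of the two components.
  have hfin : κ / 2 * E ≤ 2 * (B * (ε * √ε)) * √E := by
    have h1 := (abs_le.1 (hR 0)).2
    have h2 := (abs_le.1 (hR 1)).2
    rw [Fin.sum_univ_two] at hsplit
    nlinarith
  have hsq : √E * √E = E := Real.mul_self_sqrt hE0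
  rcases (Real.sqrt_nonneg E).eq_or_lt with h0 | h0
  · rw [← h0]; positivity
  · have h3 : κ / 2 * √E ≤ 2 * (B * (ε * √ε)) := by
      refine le_of_mul_le_mul_right ?_ h0
      rw [mul_assoc, hsq]
      exact hfin
    rw [div_mul_eq_mul_div, le_div_iff₀ hκ]
    linarith

/-- The `H¹` norm of the error. -/
theorem h1Norm_error_le (hε : 0 < ε) (hε1 : ε ≤ 1) (h : IsClassicalPair ε U P)
    (hu : MemHPer ε u G) {K : ℝ} (hK : √(dirichlet ε (fun i j => jac U i j - G i j)) ≤ K) :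
    h1Norm (strip ε) (fun i => U i - u i) ≤ ENNReal.ofReal (2 * K) := by
  set W : Fin 2 → Fin 2 → ℝ × ℝ → ℝ := fun i j => jac U i j - G i j with hWdef
  have hper : ∀ i, MemHPer10 ε (U i - u i) (W i) := fun i =>
    (h.memHPer10 hε i).sub (hu.comp i)
  have hW : ∀ i j, MemLp (W i j) 2 (vol (strip ε)) := fun i => (hper i).memLp_grad
  have nn : ∀ f : ℝ × ℝ → ℝ, 0 ≤ ∫ x in (strip ε : Set (ℝ × ℝ)), f x ^ 2 := fun f =>
    integral_nonneg fun _ => sq_nonneg _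
  refine (iInf₂_le W fun i => (hper i).hasWeakGrad hε).trans ?_
  simp_rw [eLpNorm_two_sq (hW _ _), fun i => eLpNorm_two_sq (hper i).memLp]
  have hsum : ∑ i, (ENNReal.ofReal (∫ x in (strip ε : Set (ℝ × ℝ)), (U i - u i) x ^ 2) +
      ∑ j, ENNReal.ofReal (∫ x in (strip ε : Set (ℝ × ℝ)), W i j x ^ 2)) ≤
      ENNReal.ofReal (2 * dirichlet ε W) := by
    simp only [Fin.sum_univ_two]
    rw [← ENNReal.ofReal_add (nn _) (nn _), ← ENNReal.ofReal_add (nn _) (nn _),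
      ← ENNReal.ofReal_add (nn _) (add_nonneg (nn _) (nn _)),
      ← ENNReal.ofReal_add (nn _) (add_nonneg (nn _) (nn _)),
      ← ENNReal.ofReal_add (add_nonneg (nn _) (add_nonneg (nn _) (nn _)))
        (add_nonneg (nn _) (add_nonneg (nn _) (nn _)))]
    refine ENNReal.ofReal_le_ofReal ?_
    -- As ε ≤ 1, Poincaré bounds the L² part of the norm by the Dirichlet part, whence the factor 2.
    have p : ∀ i, ∫ x in (strip ε : Set (ℝ × ℝ)), (U i - u i) x ^ 2 ≤
        ∫ x in (strip ε : Set (ℝ × ℝ)), W i 1 x ^ 2 := fun i =>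
      ((hper i).integral_sq_le hε).trans
        (mul_le_of_le_one_left (nn _) (pow_le_one₀ hε.le hε1))
    have := p 0
    have := p 1
    have := nn (W 0 0)
    have := nn (W 1 0)
    simp only [dirichlet, Fin.sum_univ_two]
    linarith
  refine (ENNReal.rpow_le_rpow hsum (by norm_num)).trans ?_
  rw [ENNReal.ofReal_rpow_of_nonneg (mul_nonneg zero_le_two (dirichlet_nonneg W)) (by norm_num),
    ← Real.sqrt_eq_rpow]
  refine ENNReal.ofReal_le_ofReal ?_
  rw [Real.sqrt_mul zero_le_two]
  have h2 : √2 ≤ 2 := by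
    rw [Real.sqrt_le_left (by norm_num)]; norm_num
  exact mul_le_mul h2 hK (Real.sqrt_nonneg _) zero_le_two

/-! ### Distributional gradients and the pressure estimate -/

lemma grad_apply (T : 𝓓'(strip ε, ℝ)) (i : Fin 2) (φ : 𝓓(strip ε, ℝ)) :
    grad T i φ = -T (∂_{dir i} φ) := rfl

lemma lineDerivOp_testFunction_apply (φ : 𝓓(strip ε, ℝ)) (i : Fin 2) (x : ℝ × ℝ) :
    (∂_{dir i} φ : 𝓓(strip ε, ℝ)) x = pd i φ x := by
  rw [TestFunction.lineDerivOp_eq_lineDerivCLM ℝ, TestFunction.lineDerivCLM_apply_of_le (by simp)]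
  exact ((contDiff_testFunction φ).differentiable (by norm_num) x).lineDeriv_eq_fderiv

lemma funDistribution_apply {g : ℝ × ℝ → ℝ} (hg : Continuous g) (φ : 𝓓(strip ε, ℝ)) :
    funDistribution (strip ε) g φ = ∫ x in (strip ε : Set (ℝ × ℝ)), g x * φ x := by
  have h1 : funDistribution (strip ε) g φ = ∫ x, φ x * g x :=
    TestFunction.integralAgainstBilinCLM_eq_integral (hg.locallyIntegrable.locallyIntegrableOn _)
  rw [h1, setIntegral_eq_integral_of_forall_compl_eq_zero]
  · simp_rw [mul_comm]
  · intro x hx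
    rw [testFunction_eq_zero φ hx, mul_zero]

/-- The `H⁻¹` norm of the error of the pressure gradient. -/
theorem hMinusOneNorm_error_le {B K M : ℝ} (hB : 0 ≤ B) (hM : 0 ≤ M) (hε : 0 < ε)
    (hν : ContDiff ℝ 1 ν) (hν_per : Function.Periodic ν 1)
    (hν_le : ∀ s ∈ Set.Ioo (0 : ℝ) 1, |ν s| ≤ M) (hf : Continuous f₁)
    (h : IsClassicalPair ε U P)
    (hres : ∀ i, ∀ x ∈ (strip ε : Set (ℝ × ℝ)), |residual ν f₁ U P i x| ≤ B)
    (hu : MemHPer ε u G) (hK : √(dirichlet ε (fun i j => jac U i j - G i j)) ≤ K)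
    {p : 𝓓'(strip ε, ℝ)} (hp : IsPressure ν f₁ ε G p) :
    hMinusOneNorm (strip ε) (fun i => grad (funDistribution (strip ε) P) i - grad p i) ≤
      ENNReal.ofReal (2 * (B * (ε * √ε)) + 4 * (M * K)) := by
  refine iSup₂_le fun φ hφ => ENNReal.ofReal_le_ofReal ?_
  set W : Fin 2 → Fin 2 → ℝ × ℝ → ℝ := fun i j => jac U i j - G i j with hWdef
  have hG : ∀ i j, MemLp (G i j) 2 (vol (strip ε)) := fun i => (hu.comp i).memLp_grad
  have hJ : ∀ i j, MemLp (jac U i j) 2 (vol (strip ε)) := fun i => (h.memHPer10 hε i).memLp_grad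
  have hW : ∀ i j, MemLp (W i j) 2 (vol (strip ε)) := fun i j => (hJ i j).sub (hG i j)
  have hνc : Continuous fun x : ℝ × ℝ => ν x.1 := hν.continuous.comp continuous_fst
  have hφm : ∀ i, MemLp (φ i) 2 (vol (strip ε)) := fun i =>
    memLp_of_continuous (contDiff_testFunction (φ i)).continuous
  have hφd : ∀ i j, MemLp (pd j (φ i)) 2 (vol (strip ε)) := fun i j =>
    memLp_of_continuous (continuous_pd (contDiff_testFunction (φ i)) j)
  -- The test field need not be divergence-free here, so the pressure term stays and yields the
  -- gradient of `P`.
  have hcl := h.weak_form (f₁ := f₁) hν hν_per hf hφm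
    (fun i => (isStripTest_testFunction (φ i)).integratesByParts hε)
  have hD : ∀ i j, ∫ x in (strip ε : Set (ℝ × ℝ)), pd j (φ i) x ^ 2 ≤ 1 := fun i j =>
    (integral_sq_le_dirichlet (ε := ε) (fun i j => pd j (φ i)) i j).trans hφ
  have hT : ∀ i, (grad (funDistribution (strip ε) P) i - grad p i) (φ i) =
      -(∫ x in (strip ε : Set (ℝ × ℝ)), P x * pd i (φ i) x) -
        ((∫ x in (strip ε : Set (ℝ × ℝ)), force f₁ i x * φ i x) -
          ∑ j, ∫ x in (strip ε : Set (ℝ × ℝ)), ν x.1 * symGrad G i j x * pd j (φ i) x) := by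
    intro i
    have h1 : grad p i (φ i) = (∫ x in (strip ε : Set (ℝ × ℝ)), force f₁ i x * φ i x) -
          ∑ j, ∫ x in (strip ε : Set (ℝ × ℝ)), ν x.1 * symGrad G i j x * pd j (φ i) x := by
      rw [← hp i (φ i)]; ring
    have h2 : grad (funDistribution (strip ε) P) i (φ i) =
        -(∫ x in (strip ε : Set (ℝ × ℝ)), P x * pd i (φ i) x) := by
      rw [grad_apply, funDistribution_apply h.smooth_pressure.continuous]
      simp_rw [lineDerivOp_testFunction_apply]
    rw [← h1, ← h2]
    rfl
  have hsym : ∀ i j, ∫ x in (strip ε : Set (ℝ × ℝ)), ν x.1 * symGrad W i j x * pd j (φ i) x =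
      (∫ x in (strip ε : Set (ℝ × ℝ)), stress ν U i j x * pd j (φ i) x) -
        ∫ x in (strip ε : Set (ℝ × ℝ)), ν x.1 * symGrad G i j x * pd j (φ i) x := by
    intro i j
    rw [← integral_sub (integrable_mul_of_memLp
      (memLp_of_continuous (contDiff_stress hν h.smooth i j).continuous) (hφd i j))
      (integrable_mul_of_memLp (memLp_mul_of_continuous hνc (memLp_symGrad hG i j)) (hφd i j))]
    refine integral_congr_ae (Filter.Eventually.of_forall fun x => ?_)
    simp only [stress, symGrad, hWdef, Pi.sub_apply]
    ring
  have hK0 : 0 ≤ K := (Real.sqrt_nonneg _).trans hK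
  have hvis : ∀ i j, |∫ x in (strip ε : Set (ℝ × ℝ)), ν x.1 * symGrad W i j x * pd j (φ i) x| ≤
      M * K := by
    intro i j
    have hm := memLp_mul_of_continuous hνc (memLp_symGrad hW i j)
    refine (abs_integral_mul_le hm (hφd i j)).trans ?_
    have h1 : √(∫ x in (strip ε : Set (ℝ × ℝ)), pd j (φ i) x ^ 2) ≤ 1 :=
      Real.sqrt_le_one.2 (hD i j)
    have h2 : √(∫ x in (strip ε : Set (ℝ × ℝ)), (ν x.1 * symGrad W i j x) ^ 2) ≤ M * K := by
      refine (Real.sqrt_le_sqrt (y := M ^ 2 * dirichlet ε W) ?_).trans ?_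
      · refine le_trans ?_ (mul_le_mul_of_nonneg_left (integral_symGrad_sq_le hW i j) (sq_nonneg M))
        rw [← integral_const_mul]
        refine setIntegral_mono_on (integrable_sq_of_memLp hm)
          ((integrable_sq_of_memLp (memLp_symGrad hW i j)).const_mul _) measurableSet_strip
          fun x hx => ?_
        rw [mul_pow]
        refine mul_le_mul_of_nonneg_right ?_ (sq_nonneg _)
        have := abs_le.1 (hν_le x.1 hx.1)
        exact sq_le_sq' this.1 this.2
      · rw [Real.sqrt_mul (sq_nonneg M), Real.sqrt_sq hM]
        exact mul_le_mul_of_nonneg_left hK hM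
    calc _ ≤ M * K * 1 := mul_le_mul h2 h1 (Real.sqrt_nonneg _) (by positivity)
      _ = M * K := mul_one _
  have hR : ∀ i, |∫ x in (strip ε : Set (ℝ × ℝ)), residual ν f₁ U P i x * φ i x| ≤
      B * (ε * √ε) := fun i => by
    have := abs_integral_mul_le_of_poincare hε (continuous_residual hν hf h i) hB (hres i) (hφm i)
      ((isStripTest_testFunction (φ i)).integral_sq_le hε) (hD i 1)
    rwa [Real.sqrt_one, mul_one] at this
  -- The forces cancel, leaving the residual and the viscous stress of the error.
  have key : ∑ i, (grad (funDistribution (strip ε) P) i - grad p i) (φ i) =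
      (∑ i, ∫ x in (strip ε : Set (ℝ × ℝ)), residual ν f₁ U P i x * φ i x) -
        ∑ i, ∑ j, ∫ x in (strip ε : Set (ℝ × ℝ)), ν x.1 * symGrad W i j x * pd j (φ i) x := by
    simp_rw [hT, hsym]
    simp only [Fin.sum_univ_two] at hcl ⊢
    linarith
  rw [key]
  simp only [Fin.sum_univ_two]
  rw [abs_le]
  have r0 := abs_le.1 (hR 0)
  have r1 := abs_le.1 (hR 1)
  have v00 := abs_le.1 (hvis 0 0)
  have v01 := abs_le.1 (hvis 0 1)
  have v10 := abs_le.1 (hvis 1 0)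
  have v11 := abs_le.1 (hvis 1 1)
  constructor <;> linarith [r0.1, r0.2, r1.1, r1.2, v00.1, v00.2, v01.1, v01.2, v10.1, v10.2,
    v11.1, v11.2]

end Energy

/-! ### The residual of the ansatz -/

section Ansatz

variable {ν f₁ : ℝ → ℝ} {ε : ℝ} {k n m : ℕ} {a : Coeffs} {w : ℕ → ℝ × ℝ → ℝ}

/-- The dilation `x ↦ (x₁, x₂ / ε)`. -/
def dilate (ε : ℝ) (x : ℝ × ℝ) : ℝ × ℝ := (x.1, x.2 / ε)

/-- The partial sum `∑_{j < n} ε^{j + m} w_j(x₁, x₂ / ε)`. -/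
def series (ε : ℝ) (n m : ℕ) (w : ℕ → ℝ × ℝ → ℝ) (x : ℝ × ℝ) : ℝ :=
  ∑ j ∈ Finset.range n, ε ^ (j + m) * w j (dilate ε x)

lemma contDiff_dilate {r : WithTop ℕ∞} : ContDiff ℝ r (dilate ε) :=
  contDiff_fst.prodMk (contDiff_snd.div_const ε)

lemma contDiff_series {r : WithTop ℕ∞} (hw : ∀ j < n, ContDiff ℝ r (w j)) :
    ContDiff ℝ r (series ε n m w) :=
  ContDiff.sum fun j hj => contDiff_const.mul ((hw j (Finset.mem_range.1 hj)).comp contDiff_dilate)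

lemma series_congr {x y : ℝ × ℝ} (h : ∀ j < n, w j (dilate ε x) = w j (dilate ε y)) :
    series ε n m w x = series ε n m w y :=
  Finset.sum_congr rfl fun j hj => by rw [h j (Finset.mem_range.1 hj)]

lemma series_eq_zero {x : ℝ × ℝ} (h : ∀ j < n, w j (dilate ε x) = 0) : series ε n m w x = 0 :=
  Finset.sum_eq_zero fun j hj => by rw [h j (Finset.mem_range.1 hj), mul_zero]

lemma pd_zero_dilate {v : ℝ × ℝ → ℝ} (hv : Differentiable ℝ v) (x : ℝ × ℝ) :
    pd 0 (fun y => v (dilate ε y)) x = pd 0 v (dilate ε x) :=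
  pd_fst_eq ((hv.comp (contDiff_dilate.differentiable one_ne_zero)) x)
    (hasDerivAt_fst (x := dilate ε x) (hv _))

lemma pd_one_dilate {v : ℝ × ℝ → ℝ} (hv : Differentiable ℝ v) (x : ℝ × ℝ) :
    pd 1 (fun y => v (dilate ε y)) x = ε⁻¹ * pd 1 v (dilate ε x) := by
  refine pd_snd_eq ((hv.comp (contDiff_dilate.differentiable one_ne_zero)) x) ?_
  have h1 := hasDerivAt_snd (x := dilate ε x) (hv _)
  have h2 := (hasDerivAt_id x.2).div_const ε
  exact (h1.comp x.2 h2).congr_deriv (by rw [one_div, mul_comm])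

lemma pd_zero_series (hw : ∀ j < n, ContDiff ℝ 1 (w j)) :
    pd 0 (series ε n m w) = series ε n m (fun j => pd 0 (w j)) := by
  funext x
  have hd : ∀ j ∈ Finset.range n, Differentiable ℝ (w j) := fun j hj =>
    (hw j (Finset.mem_range.1 hj)).differentiable one_ne_zero
  have hd' : ∀ j ∈ Finset.range n, Differentiable ℝ fun y => w j (dilate ε y) := fun j hj =>
    (hd j hj).comp (contDiff_dilate.differentiable one_ne_zero)
  change pd 0 (fun y => ∑ j ∈ Finset.range n, ε ^ (j + m) * w j (dilate ε y)) x = _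
  rw [pd_sum _ fun j hj => ((hd' j hj) x).const_mul _]
  refine Finset.sum_congr rfl fun j hj => ?_
  rw [pd_const_mul _ (hd' j hj x), pd_zero_dilate (hd j hj)]

/-- A vertical derivative costs one power of ε, while the horizontal one preserves the exponent;
this asymmetry produces the index shifts of the recurrent system. -/
lemma pd_one_series (hε : ε ≠ 0) (hw : ∀ j < n, ContDiff ℝ 1 (w j)) :
    pd 1 (series ε n (m + 1) w) = series ε n m (fun j => pd 1 (w j)) := by
  funext x
  have hd : ∀ j ∈ Finset.range n, Differentiable ℝ (w j) := fun j hj =>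
    (hw j (Finset.mem_range.1 hj)).differentiable one_ne_zero
  have hd' : ∀ j ∈ Finset.range n, Differentiable ℝ fun y => w j (dilate ε y) := fun j hj =>
    (hd j hj).comp (contDiff_dilate.differentiable one_ne_zero)
  change pd 1 (fun y => ∑ j ∈ Finset.range n, ε ^ (j + (m + 1)) * w j (dilate ε y)) x = _
  rw [pd_sum _ fun j hj => ((hd' j hj) x).const_mul _]
  refine Finset.sum_congr rfl fun j hj => ?_
  rw [pd_const_mul _ (hd' j hj x), pd_one_dilate (hd j hj), ← add_assoc, pow_succ]
  field_simp

lemma mul_series (g : ℝ → ℝ) (x : ℝ × ℝ) :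
    g x.1 * series ε n m w x = series ε n m (fun j y => g y.1 * w j y) x := by
  simp only [series, Finset.mul_sum]
  refine Finset.sum_congr rfl fun j _ => ?_
  simp only [dilate]
  ring

/-- Moves the convention that negative indices mean zero from the coefficient to the value of an
expression in it. Only F 0 = 0 matters. -/
lemma apply_back (F : (ℝ × ℝ → ℝ) → ℝ) (hF : F 0 = 0) (j m : ℕ) :
    F (back w j m) = if m ≤ j then F (w (j - m)) else 0 := by
  unfold back
  split_ifs
  · rfl
  · exact hF

lemma sum_shift (ε : ℝ) (n m : ℕ) (b : ℕ → ℝ) :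
    ∑ j ∈ Finset.range n, ε ^ j * (if m ≤ j then b (j - m) else 0) =
      ∑ i ∈ Finset.range (n - m), ε ^ (i + m) * b i := by
  rcases le_total n m with h | h
  · rw [Nat.sub_eq_zero_of_le h, Finset.sum_range_zero]
    refine Finset.sum_eq_zero fun j hj => ?_
    rw [if_neg (by have := Finset.mem_range.1 hj; omega), mul_zero]
  · obtain ⟨l, rfl⟩ := Nat.exists_eq_add_of_le h
    rw [Finset.sum_range_add, Nat.add_sub_cancel_left]
    rw [Finset.sum_eq_zero (s := Finset.range m), zero_add]
    · refine Finset.sum_congr rfl fun i _ => ?_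
      rw [if_pos (by omega), Nat.add_sub_cancel_left, add_comm]
    · intro j hj
      rw [if_neg (by have := Finset.mem_range.1 hj; omega), mul_zero]

/-- After reindexing, the second sum is the first without its last min(m, n) terms, which all carry
exponents at least n. These are the terms the recurrent system does not cancel. -/
lemma abs_sum_sub_shift_le (hε : 0 < ε) (hε1 : ε ≤ 1) (n m : ℕ) (b : ℕ → ℝ) :
    |∑ j ∈ Finset.range n, ε ^ (j + m) * b j -
      ∑ j ∈ Finset.range n, ε ^ j * (if m ≤ j then b (j - m) else 0)| ≤
      (∑ j ∈ Finset.range n, |b j|) * ε ^ n := by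
  rw [sum_shift, ← Finset.sum_Ico_eq_sub _ (Nat.sub_le n m), Finset.sum_mul]
  refine (Finset.abs_sum_le_sum_abs _ _).trans ?_
  refine (Finset.sum_le_sum (g := fun j => |b j| * ε ^ n) fun j hj => ?_).trans
    (Finset.sum_le_sum_of_subset_of_nonneg ?_ fun j _ _ => by positivity)
  · rw [abs_mul, abs_of_pos (pow_pos hε _), mul_comm]
    have := (Finset.mem_Ico.1 hj).1
    exact mul_le_mul_of_nonneg_left (pow_le_pow_of_le_one hε.le hε1 (by omega)) (abs_nonneg _)
  · intro j hj
    exact Finset.mem_range.2 (Finset.mem_Ico.1 hj).2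

lemma dilate_mem (hε : 0 < ε) {x : ℝ × ℝ} (hx : x.2 ∈ Set.Ioo (-(ε / 2)) (ε / 2)) :
    (dilate ε x).2 ∈ Set.Ioo (-(1 / 2) : ℝ) (1 / 2) := by
  constructor
  · change -(1 / 2) < x.2 / ε
    rw [lt_div_iff₀ hε]
    linarith [hx.1]
  · change x.2 / ε < 1 / 2
    rw [div_lt_iff₀ hε]
    linarith [hx.2]

/-- The constant is uniform in ε because dilation maps every thin strip into the fixed strip of
width one, where the coefficients are bounded. -/
lemma exists_shift_bound (n m : ℕ) {b : ℕ → ℝ × ℝ → ℝ} (hb : ∀ j < n, Continuous (b j)) :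
    ∃ C, 0 ≤ C ∧ ∀ ε, 0 < ε → ε ≤ 1 → ∀ x ∈ (strip ε : Set (ℝ × ℝ)),
      |series ε n m b x -
        ∑ j ∈ Finset.range n, ε ^ j * (if m ≤ j then b (j - m) (dilate ε x) else 0)| ≤
        C * ε ^ n := by
  have hC : ∀ j, ∃ C, 0 ≤ C ∧ (j < n → ∀ x ∈ (strip 1 : Set (ℝ × ℝ)), |b j x| ≤ C) := by
    intro j
    by_cases hj : j < n
    · obtain ⟨C, h0, h1⟩ := exists_bound_strip (ε := 1) (hb j hj)
      exact ⟨C, h0, fun _ => h1⟩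
    · exact ⟨0, le_rfl, fun h => absurd h hj⟩
  choose C h0 h1 using hC
  refine ⟨∑ j ∈ Finset.range n, C j, Finset.sum_nonneg fun j _ => h0 j, fun ε hε hε1 x hx => ?_⟩
  refine (abs_sum_sub_shift_le hε hε1 n m fun j => b j (dilate ε x)).trans ?_
  refine mul_le_mul_of_nonneg_right (Finset.sum_le_sum fun j hj => ?_) (by positivity)
  exact h1 j (Finset.mem_range.1 hj) _ ⟨hx.1, dilate_mem hε hx.2⟩

lemma dilate_mem_Icc (hε : 0 < ε) {t : ℝ} (ht : t ∈ Set.Icc (-(ε / 2)) (ε / 2)) :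
    t / ε ∈ Set.Icc (-(1 / 2) : ℝ) (1 / 2) := by
  constructor
  · rw [le_div_iff₀ hε]
    linarith [ht.1]
  · rw [div_le_iff₀ hε]
    linarith [ht.2]

lemma velocity_zero : a.velocity k ε 0 = series ε (k + 1) 2 a.u₁ := rfl

lemma velocity_one : a.velocity k ε 1 = series ε (k + 1) 3 a.u₂ := rfl

lemma pressure_eq : a.pressure k ε = fun x => series ε (k + 1) 1 a.p x +
    series ε (k + 1) 0 (fun j y => a.q j y.1) x := rfl

/-- The velocity and the pressure of the ansatz are classical fields. -/
lemma IsAnsatz.isClassicalPair (h : IsAnsatz ν f₁ k a) (hε : 0 < ε) :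
    IsClassicalPair ε (a.velocity k ε) (a.pressure k ε) where
  smooth i := by
    fin_cases i
    · exact contDiff_series fun j hj => h.smooth_u₁ j (by omega)
    · exact contDiff_series fun j hj => h.smooth_u₂ j (by omega)
  smooth_pressure := by
    rw [pressure_eq]
    exact (contDiff_series fun j hj => h.smooth_p j (by omega)).add
      (contDiff_series fun j hj => (h.smooth_q j (by omega)).comp contDiff_fst)
  periodic i s t ht := by
    fin_cases i
    · exact series_congr (w := a.u₁) fun j hj => h.per_u₁ j (by omega) s _ (dilate_mem_Icc hε ht)
    · exact series_congr (w := a.u₂) fun j hj => h.per_u₂ j (by omega) s _ (dilate_mem_Icc hε ht)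
  sides t ht := by
    rw [pressure_eq]
    refine congr_arg₂ _ (series_congr fun j hj => ?_) (series_congr fun j hj => ?_)
    · simpa [dilate] using h.per_p j (by omega) 0 _ (dilate_mem_Icc hε ⟨ht.1.le, ht.2.le⟩)
    · simpa [dilate] using h.per_q j (by omega) 0
  top i s := by
    have e : dilate ε (s, ε / 2) = (s, 1 / 2) := by
      simp only [dilate, Prod.mk.injEq, true_and]
      field_simp
    fin_cases i
    · exact series_eq_zero (w := a.u₁) fun j hj => by rw [e, (h.bdry_u₁ j (by omega) s).1]
    · exact series_eq_zero (w := a.u₂) fun j hj => by rw [e, (h.bdry_u₂ j (by omega) s).1]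
  bot i s := by
    have e : dilate ε (s, -(ε / 2)) = (s, -(1 / 2)) := by
      simp only [dilate, Prod.mk.injEq, true_and]
      field_simp
    fin_cases i
    · exact series_eq_zero (w := a.u₁) fun j hj => by rw [e, (h.bdry_u₁ j (by omega) s).2]
    · exact series_eq_zero (w := a.u₂) fun j hj => by rw [e, (h.bdry_u₂ j (by omega) s).2]
  div_free x hx := by
    rw [velocity_zero, velocity_one,
      pd_zero_series fun j hj => (h.smooth_u₁ j (by omega)).of_le (by norm_num),
      pd_one_series hε.ne' fun j hj => (h.smooth_u₂ j (by omega)).of_le (by norm_num)]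
    simp only [series]
    rw [← Finset.sum_add_distrib]
    refine Finset.sum_eq_zero fun j hj => ?_
    -- Both derivatives carry the same power ε^(j+2), so the divergence vanishes term by term,
    -- without a remainder.
    rw [← mul_add, h.incompressible j (by have := Finset.mem_range.1 hj; omega) _
      (dilate_mem hε hx.2), mul_zero]

lemma contDiff_visc (hν : ContDiff ℝ 1 ν) {v : ℝ × ℝ → ℝ} (hv : ContDiff ℝ 2 v) (i : Fin 2) :
    ContDiff ℝ 1 fun y : ℝ × ℝ => ν y.1 * pd i v y :=
  (hν.comp contDiff_fst).mul (contDiff_pd hv (by norm_num) i)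

lemma stress_zero_zero (h₁ : ∀ j ≤ k, ContDiff ℝ 2 (a.u₁ j)) : stress ν (a.velocity k ε) 0 0 =
    series ε (k + 1) 2 (fun j y => ν y.1 * pd 0 (a.u₁ j) y) := by
  funext x
  rw [← mul_series]
  simp only [stress, symGrad, jac, velocity_zero]
  rw [pd_zero_series fun j hj => (h₁ j (by omega)).of_le (by norm_num)]
  ring

lemma stress_one_one (h₂ : ∀ j ≤ k, ContDiff ℝ 2 (a.u₂ j)) (hε : ε ≠ 0) : stress ν (a.velocity k ε) 1 1 =
    series ε (k + 1) 2 (fun j y => ν y.1 * pd 1 (a.u₂ j) y) := by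
  funext x
  rw [← mul_series]
  simp only [stress, symGrad, jac, velocity_one]
  rw [pd_one_series hε fun j hj => (h₂ j (by omega)).of_le (by norm_num)]
  ring

lemma stress_zero_one (h₁ : ∀ j ≤ k, ContDiff ℝ 2 (a.u₁ j))
    (h₂ : ∀ j ≤ k, ContDiff ℝ 2 (a.u₂ j)) (hε : ε ≠ 0) : stress ν (a.velocity k ε) 0 1 = fun x =>
    1 / 2 * (series ε (k + 1) 1 (fun j y => ν y.1 * pd 1 (a.u₁ j) y) x +
    series ε (k + 1) 3 (fun j y => ν y.1 * pd 0 (a.u₂ j) y) x) := by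
  funext x
  rw [← mul_series, ← mul_series]
  simp only [stress, symGrad, jac, velocity_one, velocity_zero]
  rw [pd_one_series hε fun j hj => (h₁ j (by omega)).of_le (by norm_num),
    pd_zero_series fun j hj => (h₂ j (by omega)).of_le (by norm_num)]
  ring

lemma stress_comm (U : Fin 2 → ℝ × ℝ → ℝ) (i j : Fin 2) : stress ν U i j = stress ν U j i := by
  funext x
  simp only [stress, symGrad, add_comm]

lemma pd_one_visc (hν : ContDiff ℝ 1 ν) {v : ℝ × ℝ → ℝ} (hv : ContDiff ℝ 2 v) (i : Fin 2)
    (x : ℝ × ℝ) : pd 1 (fun y => ν y.1 * pd i v y) x = ν x.1 * pd 1 (pd i v) x :=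
  pd_snd_eq ((contDiff_visc hν hv i).differentiable one_ne_zero x)
    ((hasDerivAt_snd ((contDiff_pd (m := 1) hv (by norm_num) i).differentiable
      one_ne_zero x)).const_mul (ν x.1))

/-- The residual of the first momentum equation is of order `k + 1`. -/
lemma IsAnsatz.exists_residual_zero_bound (h : IsAnsatz ν f₁ k a) (hν : ContDiff ℝ 1 ν) :
    ∃ C, 0 ≤ C ∧ ∀ ε, 0 < ε → ε ≤ 1 → ∀ x ∈ (strip ε : Set (ℝ × ℝ)),
      |residual ν f₁ (a.velocity k ε) (a.pressure k ε) 0 x| ≤ C * ε ^ (k + 1) := by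
  have s₁ := h.smooth_u₁
  have s₂ := h.smooth_u₂
  -- Only the terms entering with a shifted index (two viscous ones by 2, the pressure by 1) leave a
  -- remainder; ∂₂²u₁ and q' enter unshifted and cancel completely.
  obtain ⟨C₁, c₁, H₁⟩ := exists_shift_bound (k + 1) 2
    (b := fun j => pd 0 (fun y => ν y.1 * pd 0 (a.u₁ j) y))
    fun j hj => continuous_pd (contDiff_visc hν (s₁ j (by omega)) 0) 0
  obtain ⟨C₂, c₂, H₂⟩ := exists_shift_bound (k + 1) 2
    (b := fun j => pd 1 (fun y => ν y.1 * pd 0 (a.u₂ j) y))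
    fun j hj => continuous_pd (contDiff_visc hν (s₂ j (by omega)) 0) 1
  obtain ⟨C₃, c₃, H₃⟩ := exists_shift_bound (k + 1) 1 (b := fun j => pd 0 (a.p j))
    fun j hj => continuous_pd (h.smooth_p j (by omega)) 0
  refine ⟨C₁ + C₂ + C₃, by positivity, fun ε hε hε1 x hx => ?_⟩
  have B₁ := abs_le.1 (H₁ ε hε hε1 x hx)
  have B₂ := abs_le.1 (H₂ ε hε hε1 x hx)
  have B₃ := abs_le.1 (H₃ ε hε hε1 x hx)
  have hsq : ∀ j < k + 1, ContDiff ℝ 1 fun y : ℝ × ℝ => a.q j y.1 := fun j hj =>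
    (h.smooth_q j (by omega)).comp contDiff_fst
  have hp : pd 0 (a.pressure k ε) x = series ε (k + 1) 1 (fun j => pd 0 (a.p j)) x +
      series ε (k + 1) 0 (fun j => pd 0 (fun y => a.q j y.1)) x := by
    rw [pressure_eq, pd_add
      ((contDiff_series fun j hj => h.smooth_p j (by omega)).differentiable one_ne_zero x)
      ((contDiff_series hsq).differentiable one_ne_zero x),
      pd_zero_series fun j hj => h.smooth_p j (by omega), pd_zero_series hsq]
  have d₁ : ContDiff ℝ 1 (series ε (k + 1) 1 fun j y => ν y.1 * pd 1 (a.u₁ j) y) :=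
    contDiff_series fun j hj => contDiff_visc hν (s₁ j (by omega)) 1
  have d₂ : ContDiff ℝ 1 (series ε (k + 1) 3 fun j y => ν y.1 * pd 0 (a.u₂ j) y) :=
    contDiff_series fun j hj => contDiff_visc hν (s₂ j (by omega)) 0
  have hs1 : pd 1 (stress ν (a.velocity k ε) 0 1) x =
      1 / 2 * (series ε (k + 1) 0 (fun j => pd 1 (fun y => ν y.1 * pd 1 (a.u₁ j) y)) x +
      series ε (k + 1) 2 (fun j => pd 1 (fun y => ν y.1 * pd 0 (a.u₂ j) y)) x) := by
    rw [stress_zero_one s₁ s₂ hε.ne', pd_const_mul _ ((d₁.add d₂).differentiable one_ne_zero x),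
      pd_add (d₁.differentiable one_ne_zero x) (d₂.differentiable one_ne_zero x),
      pd_one_series hε.ne' fun j hj => contDiff_visc hν (s₁ j (by omega)) 1,
      pd_one_series hε.ne' fun j hj => contDiff_visc hν (s₂ j (by omega)) 0]
  have hs0 : pd 0 (stress ν (a.velocity k ε) 0 0) x =
      series ε (k + 1) 2 (fun j => pd 0 (fun y => ν y.1 * pd 0 (a.u₁ j) y)) x := by
    rw [stress_zero_zero s₁, pd_zero_series fun j hj => contDiff_visc hν (s₁ j (by omega)) 0]
  -- The equations of index j ≤ k, multiplied by ε^j and summed.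
  have eqn : -(∑ j ∈ Finset.range (k + 1), ε ^ j *
        (if 2 ≤ j then pd 0 (fun y => ν y.1 * pd 0 (a.u₁ (j - 2)) y) (dilate ε x) else 0))
      - 1 / 2 * series ε (k + 1) 0 (fun j => pd 1 (fun y => ν y.1 * pd 1 (a.u₁ j) y)) x
      - 1 / 2 * (∑ j ∈ Finset.range (k + 1), ε ^ j *
        (if 2 ≤ j then pd 1 (fun y => ν y.1 * pd 0 (a.u₂ (j - 2)) y) (dilate ε x) else 0))
      + (∑ j ∈ Finset.range (k + 1), ε ^ j *
        (if 1 ≤ j then pd 0 (a.p (j - 1)) (dilate ε x) else 0))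
      + series ε (k + 1) 0 (fun j => pd 0 (fun y => a.q j y.1)) x = force f₁ 0 x := by
    have hsum : ∑ j ∈ Finset.range (k + 1), ε ^ j * (if j = 0 then f₁ x.1 else 0) =
        force f₁ 0 x := by
      rw [Finset.sum_eq_single 0 (fun j _ hj => by rw [if_neg hj, mul_zero]) (by simp)]
      simp [force]
    rw [← hsum, series, series, Finset.mul_sum, Finset.mul_sum, ← Finset.sum_neg_distrib,
      ← Finset.sum_sub_distrib, ← Finset.sum_sub_distrib, ← Finset.sum_add_distrib,
      ← Finset.sum_add_distrib]
    refine Finset.sum_congr rfl fun j hj => ?_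
    have hjk : j ≤ k := by have := Finset.mem_range.1 hj; omega
    have hm := h.momentum₁ j hjk (dilate ε x) (dilate_mem hε hx.2)
    rw [apply_back (fun v => pd 0 (fun y => ν y.1 * pd 0 v y) (dilate ε x))
        (by simp [pd_zero, pd_const]),
      apply_back (fun v => pd 1 (pd 0 v) (dilate ε x)) (by simp [pd_zero]),
      apply_back (fun v => pd 0 v (dilate ε x)) (by simp [pd_zero])] at hm
    have hq : pd 0 (fun y : ℝ × ℝ => a.q j y.1) (dilate ε x) = deriv (a.q j) (dilate ε x).1 :=
      pd_fst_eq ((hsq j (by omega)).differentiable one_ne_zero _)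
        (((h.smooth_q j hjk).differentiable one_ne_zero _).hasDerivAt)
    rw [hq, pd_one_visc hν (s₁ j hjk), add_zero]
    change _ = ε ^ j * (if j = 0 then f₁ (dilate ε x).1 else 0)
    rw [← hm]
    split_ifs with c1 c2
    · rw [pd_one_visc hν (s₂ (j - 2) (by omega))]; ring
    · omega
    · ring
    · ring
  have hR : residual ν f₁ (a.velocity k ε) (a.pressure k ε) 0 x =
      -(pd 0 (stress ν (a.velocity k ε) 0 0) x + pd 1 (stress ν (a.velocity k ε) 0 1) x)
        + pd 0 (a.pressure k ε) x - force f₁ 0 x := by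
    simp only [residual, Fin.sum_univ_two]
  rw [hR, hs0, hs1, hp, ← eqn, abs_le]
  obtain ⟨b1, b1'⟩ := B₁
  obtain ⟨b2, b2'⟩ := B₂
  obtain ⟨b3, b3'⟩ := B₃
  have : 0 ≤ C₂ * ε ^ (k + 1) := by positivity
  constructor <;> linarith

/-- The residual of the second momentum equation is of order `k + 1`. -/
lemma IsAnsatz.exists_residual_one_bound (h : IsAnsatz ν f₁ k a) (hν : ContDiff ℝ 1 ν) :
    ∃ C, 0 ≤ C ∧ ∀ ε, 0 < ε → ε ≤ 1 → ∀ x ∈ (strip ε : Set (ℝ × ℝ)),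
      |residual ν f₁ (a.velocity k ε) (a.pressure k ε) 1 x| ≤ C * ε ^ (k + 1) := by
  have s₁ := h.smooth_u₁
  have s₂ := h.smooth_u₂
  -- The shifts are now 1, 3 and 1, while ∂₂p enters unshifted.
  obtain ⟨C₁, c₁, H₁⟩ := exists_shift_bound (k + 1) 1
    (b := fun j => pd 0 (fun y => ν y.1 * pd 1 (a.u₁ j) y))
    fun j hj => continuous_pd (contDiff_visc hν (s₁ j (by omega)) 1) 0
  obtain ⟨C₂, c₂, H₂⟩ := exists_shift_bound (k + 1) 3
    (b := fun j => pd 0 (fun y => ν y.1 * pd 0 (a.u₂ j) y))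
    fun j hj => continuous_pd (contDiff_visc hν (s₂ j (by omega)) 0) 0
  obtain ⟨C₃, c₃, H₃⟩ := exists_shift_bound (k + 1) 1
    (b := fun j => pd 1 (fun y => ν y.1 * pd 1 (a.u₂ j) y))
    fun j hj => continuous_pd (contDiff_visc hν (s₂ j (by omega)) 1) 1
  refine ⟨C₁ + C₂ + C₃, by positivity, fun ε hε hε1 x hx => ?_⟩
  obtain ⟨b1, b1'⟩ := abs_le.1 (H₁ ε hε hε1 x hx)
  obtain ⟨b2, b2'⟩ := abs_le.1 (H₂ ε hε hε1 x hx)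
  obtain ⟨b3, b3'⟩ := abs_le.1 (H₃ ε hε hε1 x hx)
  have hsq : ∀ j < k + 1, ContDiff ℝ 1 fun y : ℝ × ℝ => a.q j y.1 := fun j hj =>
    (h.smooth_q j (by omega)).comp contDiff_fst
  have hp : pd 1 (a.pressure k ε) x = series ε (k + 1) 0 (fun j => pd 1 (a.p j)) x := by
    have hq0 : pd 1 (series ε (k + 1) 0 (fun j y => a.q j y.1)) x = 0 :=
      pd_snd_eq ((contDiff_series hsq).differentiable one_ne_zero x)
        (hasDerivAt_const x.2 (series ε (k + 1) 0 (fun j y => a.q j y.1) x))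
    rw [pressure_eq, pd_add
      ((contDiff_series fun j hj => h.smooth_p j (by omega)).differentiable one_ne_zero x)
      ((contDiff_series hsq).differentiable one_ne_zero x), hq0, add_zero,
      pd_one_series hε.ne' fun j hj => h.smooth_p j (by omega)]
  have d₁ : ContDiff ℝ 1 (series ε (k + 1) 1 fun j y => ν y.1 * pd 1 (a.u₁ j) y) :=
    contDiff_series fun j hj => contDiff_visc hν (s₁ j (by omega)) 1
  have d₂ : ContDiff ℝ 1 (series ε (k + 1) 3 fun j y => ν y.1 * pd 0 (a.u₂ j) y) :=
    contDiff_series fun j hj => contDiff_visc hν (s₂ j (by omega)) 0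
  have hs0 : pd 0 (stress ν (a.velocity k ε) 1 0) x =
      1 / 2 * (series ε (k + 1) 1 (fun j => pd 0 (fun y => ν y.1 * pd 1 (a.u₁ j) y)) x +
      series ε (k + 1) 3 (fun j => pd 0 (fun y => ν y.1 * pd 0 (a.u₂ j) y)) x) := by
    rw [stress_comm, stress_zero_one s₁ s₂ hε.ne',
      pd_const_mul _ ((d₁.add d₂).differentiable one_ne_zero x),
      pd_add (d₁.differentiable one_ne_zero x) (d₂.differentiable one_ne_zero x),
      pd_zero_series fun j hj => contDiff_visc hν (s₁ j (by omega)) 1,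
      pd_zero_series fun j hj => contDiff_visc hν (s₂ j (by omega)) 0]
  have hs1 : pd 1 (stress ν (a.velocity k ε) 1 1) x =
      series ε (k + 1) 1 (fun j => pd 1 (fun y => ν y.1 * pd 1 (a.u₂ j) y)) x := by
    rw [stress_one_one s₂ hε.ne',
      pd_one_series hε.ne' fun j hj => contDiff_visc hν (s₂ j (by omega)) 1]
  have eqn : series ε (k + 1) 0 (fun j => pd 1 (a.p j)) x =
      1 / 2 * (∑ j ∈ Finset.range (k + 1), ε ^ j *
        (if 1 ≤ j then pd 0 (fun y => ν y.1 * pd 1 (a.u₁ (j - 1)) y) (dilate ε x) else 0))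
      + 1 / 2 * (∑ j ∈ Finset.range (k + 1), ε ^ j *
        (if 3 ≤ j then pd 0 (fun y => ν y.1 * pd 0 (a.u₂ (j - 3)) y) (dilate ε x) else 0))
      + (∑ j ∈ Finset.range (k + 1), ε ^ j *
        (if 1 ≤ j then pd 1 (fun y => ν y.1 * pd 1 (a.u₂ (j - 1)) y) (dilate ε x) else 0)) := by
    rw [series, Finset.mul_sum, Finset.mul_sum, ← Finset.sum_add_distrib,
      ← Finset.sum_add_distrib]
    refine Finset.sum_congr rfl fun j hj => ?_
    have hjk : j ≤ k := by have := Finset.mem_range.1 hj; omega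
    have hm := h.momentum₂ j hjk (dilate ε x) (dilate_mem hε hx.2)
    -- The derivative of the sum is split before the shifted coefficients are unfolded, so those
    -- replaced by zero must be covered too.
    have z : ∀ v : ℝ × ℝ → ℝ, v = 0 ∨ ContDiff ℝ 2 v → ∀ i : Fin 2,
        ContDiff ℝ 1 fun y : ℝ × ℝ => ν y.1 * pd i v y := by
      rintro v (rfl | hv) i
      · simpa [pd_zero] using (contDiff_const : ContDiff ℝ 1 fun _ : ℝ × ℝ => (0 : ℝ))
      · exact contDiff_visc hν hv i
    have zb : ∀ (v : ℕ → ℝ × ℝ → ℝ), (∀ j ≤ k, ContDiff ℝ 2 (v j)) → ∀ m,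
        back v j m = 0 ∨ ContDiff ℝ 2 (back v j m) := by
      intro v hv m
      unfold back
      split_ifs
      · exact Or.inr (hv _ (by omega))
      · exact Or.inl rfl
    simp_rw [mul_add] at hm
    rw [pd_add ((z _ (zb _ s₁ 1) 1).differentiable one_ne_zero _)
        ((z _ (zb _ s₂ 3) 0).differentiable one_ne_zero _),
      apply_back (fun v => pd 0 (fun y => ν y.1 * pd 1 v y) (dilate ε x))
        (by simp [pd_zero, pd_const]),
      apply_back (fun v => pd 0 (fun y => ν y.1 * pd 0 v y) (dilate ε x))
        (by simp [pd_zero, pd_const]),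
      apply_back (fun v => pd 1 (pd 1 v) (dilate ε x)) (by simp [pd_zero])] at hm
    rw [add_zero, ← sub_eq_zero.1 hm]
    split_ifs with c1 c2
    · rw [pd_one_visc hν (s₂ (j - 1) (by omega))]; ring
    · rw [pd_one_visc hν (s₂ (j - 1) (by omega))]; ring
    · omega
    · ring
  have hR : residual ν f₁ (a.velocity k ε) (a.pressure k ε) 1 x =
      -(pd 0 (stress ν (a.velocity k ε) 1 0) x + pd 1 (stress ν (a.velocity k ε) 1 1) x)
        + pd 1 (a.pressure k ε) x := by
    simp [residual, Fin.sum_univ_two, force]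
  rw [hR, hs0, hs1, hp, eqn, abs_le]
  have : 0 ≤ C₁ * ε ^ (k + 1) := by positivity
  have : 0 ≤ C₂ * ε ^ (k + 1) := by positivity
  constructor <;> linarith

/-- The error estimate for the ansatz. -/
theorem IsAnsatz.exists_error_bound {κ : ℝ} (hκ : 0 < κ) (hν : ContDiff ℝ 1 ν)
    (hν_per : Function.Periodic ν 1) (hν_pos : ∀ s ∈ Set.Ioo (0 : ℝ) 1, κ ≤ ν s)
    (hf : Continuous f₁) (h : IsAnsatz ν f₁ k a) :
    ∃ C : ℝ, ∀ ε : ℝ, 0 < ε → ε ≤ 1 → ∀ u G, IsWeakSolution ν f₁ ε u G →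
      h1Norm (strip ε) (fun i => a.velocity k ε i - u i)
        ≤ ENNReal.ofReal (C * ε ^ ((k : ℝ) + 5 / 2)) ∧
      ∀ p : 𝓓'(strip ε, ℝ), IsPressure ν f₁ ε G p →
        hMinusOneNorm (strip ε) (fun i =>
          grad (funDistribution (strip ε) (a.pressure k ε)) i - grad p i)
          ≤ ENNReal.ofReal (C * ε ^ ((k : ℝ) + 5 / 2)) := by
  obtain ⟨C₀, c₀, R₀⟩ := h.exists_residual_zero_bound hν
  obtain ⟨C₁, c₁, R₁⟩ := h.exists_residual_one_bound hν
  obtain ⟨M, hM⟩ := (isCompact_Icc (a := (0 : ℝ)) (b := 1)).exists_bound_of_continuousOn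
    hν.continuous.continuousOn
  have hM0 : 0 ≤ M := (norm_nonneg _).trans (hM 0 ⟨le_rfl, zero_le_one⟩)
  set D := C₀ + C₁ with hD
  have hD0 : 0 ≤ D := add_nonneg c₀ c₁
  refine ⟨8 / κ * D + 2 * D + 16 / κ * (M * D), fun ε hε hε1 u G hu => ?_⟩
  -- Residual order, times ε from Poincaré, times √ε from the area.
  have hpow : ε ^ (k + 1) * (ε * √ε) = ε ^ ((k : ℝ) + 5 / 2) := by
    rw [Real.sqrt_eq_rpow, ← mul_assoc, ← pow_succ, ← Real.rpow_natCast, ← Real.rpow_add hε]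
    congr 1
    push_cast
    ring
  have hres : ∀ i, ∀ x ∈ (strip ε : Set (ℝ × ℝ)),
      |residual ν f₁ (a.velocity k ε) (a.pressure k ε) i x| ≤ D * ε ^ (k + 1) := by
    intro i x hx
    have hpos : 0 ≤ ε ^ (k + 1) := by positivity
    fin_cases i
    · exact (R₀ ε hε hε1 x hx).trans (mul_le_mul_of_nonneg_right (by linarith) hpos)
    · exact (R₁ ε hε hε1 x hx).trans (mul_le_mul_of_nonneg_right (by linarith) hpos)
  have hcp := h.isClassicalPair hε
  have hB : 0 ≤ D * ε ^ (k + 1) := by positivity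
  have hE := sqrt_dirichlet_error_le hκ hB hε hν hν_per hν_pos hf hcp hres hu
  rw [mul_assoc D, hpow] at hE
  have hr : 0 ≤ ε ^ ((k : ℝ) + 5 / 2) := by positivity
  have hκ' : 0 ≤ 1 / κ := by positivity
  constructor
  · refine (h1Norm_error_le hε hε1 hcp hu.mem hE).trans (ENNReal.ofReal_le_ofReal ?_)
    have h1 : 0 ≤ 2 * D + 16 / κ * (M * D) := by positivity
    have h2 : 2 * (4 / κ * (D * ε ^ ((k : ℝ) + 5 / 2))) =
        8 / κ * D * ε ^ ((k : ℝ) + 5 / 2) := by ring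
    rw [h2]
    exact mul_le_mul_of_nonneg_right (by linarith) hr
  · intro p hp
    refine (hMinusOneNorm_error_le hB hM0 hε hν hν_per (fun s hs => hM s ⟨hs.1.le, hs.2.le⟩) hf hcp
      hres hu.mem hE hp).trans (ENNReal.ofReal_le_ofReal ?_)
    rw [mul_assoc D, hpow]
    have h1 : 0 ≤ 8 / κ * D := by positivity
    have h2 : 2 * (D * ε ^ ((k : ℝ) + 5 / 2)) + 4 * (M * (4 / κ * (D * ε ^ ((k : ℝ) + 5 / 2)))) =
        (2 * D + 16 / κ * (M * D)) * ε ^ ((k : ℝ) + 5 / 2) := by ring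
    rw [h2]
    exact mul_le_mul_of_nonneg_right (by linarith) hr

end Ansatz

/-! ### Existence of the coefficients -/

section Existence

variable {ν f₁ : ℝ → ℝ} {κ : ℝ}

/-- Continuity carries the bound to the closed period and periodicity to the whole line. -/
lemma le_of_periodic (hν : Continuous ν) (hν_per : Function.Periodic ν 1)
    (hν_pos : ∀ s ∈ Set.Ioo (0 : ℝ) 1, κ ≤ ν s) (s : ℝ) : κ ≤ ν s := by
  obtain ⟨y, hy, hs⟩ := hν_per.exists_mem_Ico₀ zero_lt_one s
  rw [hs]
  have h1 : closure (Set.Ioo (0 : ℝ) 1) ⊆ {t | κ ≤ ν t} :=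
    closure_minimal hν_pos (isClosed_le continuous_const hν)
  rw [closure_Ioo zero_ne_one] at h1
  exact h1 ⟨hy.1, hy.2.le⟩

/-- The increment of a primitive over a period is the mean of `g`, here zero. -/
lemma exists_periodic_primitive {g : ℝ → ℝ} (hg : Continuous g) (hper : Function.Periodic g 1)
    (h0 : ∫ s in (0 : ℝ)..1, g s = 0) :
    ∃ q : ℝ → ℝ, Function.Periodic q 1 ∧ ∀ s, HasDerivAt q (g s) s := by
  refine ⟨fun s => ∫ τ in (0 : ℝ)..s, g τ, fun s => ?_, fun s => hg.integral_hasStrictDerivAt 0 s |>.hasDerivAt⟩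
  have h1 := hper.intervalIntegral_add_eq s 0
  rw [zero_add, h0] at h1
  have h2 := intervalIntegral.integral_add_adjacent_intervals
    (hg.intervalIntegrable (μ := volume) 0 s) (hg.intervalIntegrable s (s + 1))
  rw [h1, add_zero] at h2
  exact h2.symm

/-- The mean of `g - c ν` vanishes for a suitable constant `c`. -/
lemma exists_mean_zero (hν : Continuous ν) (hpos : ∀ s, 0 < ν s) {g : ℝ → ℝ} (hg : Continuous g) :
    ∃ c : ℝ, ∫ s in (0 : ℝ)..1, (g s - c * ν s) = 0 := by
  have hI : 0 < ∫ s in (0 : ℝ)..1, ν s :=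
    intervalIntegral.intervalIntegral_pos_of_pos (hν.intervalIntegrable _ _) hpos zero_lt_one
  refine ⟨(∫ s in (0 : ℝ)..1, g s) / ∫ s in (0 : ℝ)..1, ν s, ?_⟩
  rw [intervalIntegral.integral_sub (hg.intervalIntegrable _ _)
    ((hν.intervalIntegrable _ _).const_mul _), intervalIntegral.integral_const_mul,
    div_mul_cancel₀ _ hI.ne', sub_self]

/-! ### Polynomial profiles with smooth periodic coefficients -/

/-- Smooth `1`-periodic functions. -/
structure IsSmoothPeriodic (c : ℝ → ℝ) : Prop where
  smooth : ContDiff ℝ ∞ c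
  periodic : Function.Periodic c 1

lemma periodic_deriv {c : ℝ → ℝ} (hc : Function.Periodic c 1) :
    Function.Periodic (deriv c) 1 := fun s => by
  rw [← deriv_comp_add_const, hc.funext]

lemma IsSmoothPeriodic.deriv {c : ℝ → ℝ} (hc : IsSmoothPeriodic c) :
    IsSmoothPeriodic (deriv c) where
  smooth := (contDiff_infty_iff_deriv.1 hc.smooth).2
  periodic := periodic_deriv hc.periodic

lemma IsSmoothPeriodic.mul {c d : ℝ → ℝ} (hc : IsSmoothPeriodic c) (hd : IsSmoothPeriodic d) :
    IsSmoothPeriodic (fun s => c s * d s) where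
  smooth := hc.smooth.mul hd.smooth
  periodic := hc.periodic.mul hd.periodic

lemma IsSmoothPeriodic.sub {c d : ℝ → ℝ} (hc : IsSmoothPeriodic c) (hd : IsSmoothPeriodic d) :
    IsSmoothPeriodic (fun s => c s - d s) where
  smooth := hc.smooth.sub hd.smooth
  periodic := hc.periodic.sub hd.periodic

lemma IsSmoothPeriodic.const (r : ℝ) : IsSmoothPeriodic fun _ => r where
  smooth := contDiff_const
  periodic _ := rfl

/-- Polynomials in the second variable whose coefficients are smooth periodic functions of the
first one. -/
def profiles : Submodule ℝ (ℝ × ℝ → ℝ) :=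
  Submodule.span ℝ {w | ∃ (c : ℝ → ℝ) (n : ℕ), IsSmoothPeriodic c ∧ w = fun x => c x.1 * x.2 ^ n}

lemma mul_pow_mem_profiles {c : ℝ → ℝ} (hc : IsSmoothPeriodic c) (n : ℕ) :
    (fun x : ℝ × ℝ => c x.1 * x.2 ^ n) ∈ profiles :=
  Submodule.subset_span ⟨c, n, hc, rfl⟩

lemma fst_mem_profiles {c : ℝ → ℝ} (hc : IsSmoothPeriodic c) :
    (fun x : ℝ × ℝ => c x.1) ∈ profiles := by
  simpa using mul_pow_mem_profiles hc 0

variable {w v : ℝ × ℝ → ℝ}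

lemma add_mem_profiles (hw : w ∈ profiles) (hv : v ∈ profiles) :
    (fun x => w x + v x) ∈ profiles := profiles.add_mem hw hv

lemma sub_mem_profiles (hw : w ∈ profiles) (hv : v ∈ profiles) :
    (fun x => w x - v x) ∈ profiles := profiles.sub_mem hw hv

lemma neg_mem_profiles (hw : w ∈ profiles) : (fun x => -w x) ∈ profiles := profiles.neg_mem hw

lemma const_mul_mem_profiles (r : ℝ) (hw : w ∈ profiles) : (fun x => r * w x) ∈ profiles :=
  profiles.smul_mem r hw

lemma contDiff_of_mem_profiles (hw : w ∈ profiles) : ContDiff ℝ ∞ w := by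
  induction hw using Submodule.span_induction with
  | mem w h =>
    obtain ⟨c, n, hc, rfl⟩ := h
    exact (hc.smooth.comp contDiff_fst).mul (contDiff_snd.pow n)
  | zero => exact contDiff_const
  | add w v _ _ hw hv => exact hw.add hv
  | smul r w _ hw => exact contDiff_const.mul hw

lemma differentiable_of_mem_profiles (hw : w ∈ profiles) : Differentiable ℝ w :=
  (contDiff_of_mem_profiles hw).differentiable (by simp)

lemma periodic_of_mem_profiles (hw : w ∈ profiles) (s t : ℝ) : w (s + 1, t) = w (s, t) := by
  induction hw using Submodule.span_induction with
  | mem w h =>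
    obtain ⟨c, n, hc, rfl⟩ := h
    simp only [hc.periodic s]
  | zero => rfl
  | add w v _ _ hw hv => simp only [Pi.add_apply, hw, hv]
  | smul r w _ hw => simp only [Pi.smul_apply, hw]

lemma trace_isSmoothPeriodic (hw : w ∈ profiles) (t : ℝ) : IsSmoothPeriodic fun s => w (s, t) where
  smooth := (contDiff_of_mem_profiles hw).comp (contDiff_id.prodMk contDiff_const)
  periodic s := periodic_of_mem_profiles hw s t

lemma mul_mem_profiles {g : ℝ → ℝ} (hg : IsSmoothPeriodic g) (hw : w ∈ profiles) :
    (fun x => g x.1 * w x) ∈ profiles := by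
  induction hw using Submodule.span_induction with
  | mem w h =>
    obtain ⟨c, n, hc, rfl⟩ := h
    simpa only [mul_assoc] using mul_pow_mem_profiles (hg.mul hc) n
  | zero =>
    simp only [Pi.zero_apply, mul_zero]
    exact profiles.zero_mem
  | add w v _ _ hw hv => simpa only [Pi.add_apply, mul_add] using add_mem_profiles hw hv
  | smul r w _ hw =>
    simpa only [Pi.smul_apply, smul_eq_mul, mul_left_comm] using const_mul_mem_profiles r hw

lemma pd_mem_profiles (hw : w ∈ profiles) (i : Fin 2) : pd i w ∈ profiles := by
  induction hw using Submodule.span_induction with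
  | mem w h =>
    obtain ⟨c, n, hc, rfl⟩ := h
    have hd := differentiable_of_mem_profiles (mul_pow_mem_profiles hc n)
    fin_cases i
    · convert mul_pow_mem_profiles hc.deriv n using 1
      funext x
      exact pd_fst_eq (hd x)
        (((hc.smooth.differentiable (by simp) x.1).hasDerivAt).mul_const (x.2 ^ n))
    -- For n = 0 the truncated exponent is harmless, since the factor n vanishes.
    · convert const_mul_mem_profiles n (mul_pow_mem_profiles hc (n - 1)) using 1
      funext x
      refine pd_snd_eq (hd x) (((hasDerivAt_pow n x.2).const_mul (c x.1)).congr_deriv ?_)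
      ring
  | zero => rw [pd_zero]; exact profiles.zero_mem
  | add w v hw' hv' hw hv =>
    convert add_mem_profiles hw hv using 1
    funext x
    exact pd_add (differentiable_of_mem_profiles hw' x) (differentiable_of_mem_profiles hv' x)
  | smul r w hw' hw =>
    convert const_mul_mem_profiles r hw using 1
    funext x
    exact pd_const_mul r (differentiable_of_mem_profiles hw' x)

lemma exists_primitive (hw : w ∈ profiles) : ∃ I ∈ profiles, ∀ x, pd 1 I x = w x := by
  induction hw using Submodule.span_induction with
  | mem w h =>
    obtain ⟨c, n, hc, rfl⟩ := h
    have hm := const_mul_mem_profiles (1 / (n + 1 : ℝ)) (mul_pow_mem_profiles hc (n + 1))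
    refine ⟨_, hm, fun x => ?_⟩
    refine pd_snd_eq (differentiable_of_mem_profiles hm x)
      ((((hasDerivAt_pow (n + 1) x.2).const_mul (c x.1)).const_mul (1 / (n + 1 : ℝ))).congr_deriv ?_)
    have : (n : ℝ) + 1 ≠ 0 := by positivity
    push_cast
    field_simp
  | zero => exact ⟨0, profiles.zero_mem, fun x => by rw [pd_zero]⟩
  | add w v _ _ hw hv =>
    obtain ⟨I, hI, eI⟩ := hw
    obtain ⟨J, hJ, eJ⟩ := hv
    exact ⟨_, add_mem_profiles hI hJ, fun x => by
      rw [pd_add (differentiable_of_mem_profiles hI x) (differentiable_of_mem_profiles hJ x), eI, eJ]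
      rfl⟩
  | smul r w _ hw =>
    obtain ⟨I, hI, eI⟩ := hw
    exact ⟨_, const_mul_mem_profiles r hI, fun x => by
      rw [pd_const_mul r (differentiable_of_mem_profiles hI x), eI]
      rfl⟩

/-- A primitive in the second variable vanishing at `t`. -/
lemma exists_primitive_vanishing (hw : w ∈ profiles) (t : ℝ) :
    ∃ I ∈ profiles, (∀ x, pd 1 I x = w x) ∧ ∀ s, I (s, t) = 0 := by
  obtain ⟨I, hI, eI⟩ := exists_primitive hw
  have hm := sub_mem_profiles hI (fst_mem_profiles (trace_isSmoothPeriodic hI t))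
  refine ⟨_, hm, fun x => ?_, fun s => sub_self _⟩
  refine pd_snd_eq (differentiable_of_mem_profiles hm x) ?_
  rw [← eI x]
  exact (hasDerivAt_snd (differentiable_of_mem_profiles hI x)).sub_const (I (x.1, t))

/-- A primitive in the second variable with mean zero over `[-1/2, 1/2]`. -/
lemma exists_primitive_mean_zero (hw : w ∈ profiles) :
    ∃ I ∈ profiles, (∀ x, pd 1 I x = w x) ∧
      ∀ s, ∫ ξ in (-(1 / 2) : ℝ)..(1 / 2), I (s, ξ) = 0 := by
  obtain ⟨I, hI, eI⟩ := exists_primitive hw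
  -- The mean of `I` is a difference of two traces of its primitive, which shows that it is a smooth
  -- periodic function of the first variable.
  obtain ⟨R, hR, eR⟩ := exists_primitive hI
  have hm := sub_mem_profiles hI (fst_mem_profiles
    ((trace_isSmoothPeriodic hR (1 / 2)).sub (trace_isSmoothPeriodic hR (-(1 / 2)))))
  refine ⟨_, hm, fun x => ?_, fun s => ?_⟩
  · refine pd_snd_eq (differentiable_of_mem_profiles hm x) ?_
    rw [← eI x]
    exact (hasDerivAt_snd (differentiable_of_mem_profiles hI x)).sub_const
      (R (x.1, 1 / 2) - R (x.1, -(1 / 2)))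
  · have hc : Continuous fun ξ => I (s, ξ) :=
      (contDiff_of_mem_profiles hI).continuous.comp (continuous_const.prodMk continuous_id)
    have h1 : ∫ ξ in (-(1 / 2) : ℝ)..(1 / 2), I (s, ξ) = R (s, 1 / 2) - R (s, -(1 / 2)) :=
      intervalIntegral.integral_eq_sub_of_hasDerivAt (f := fun ξ => R (s, ξ))
        (fun ξ _ => by
          rw [← eR (s, ξ)]
          exact hasDerivAt_snd (x := (s, ξ)) (differentiable_of_mem_profiles hR _))
        (hc.intervalIntegrable _ _)
    simp only
    rw [intervalIntegral.integral_sub (hc.intervalIntegrable _ _) (by simp), h1,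
      intervalIntegral.integral_const]
    norm_num

/-! ### Cross-section problems -/

/-- The Dirichlet problem for the second derivative in the second variable. -/
lemma exists_dirichlet_solution (hw : w ∈ profiles) :
    ∃ U ∈ profiles, (∀ x, pd 1 (pd 1 U) x = w x) ∧ ∀ s, U (s, 1 / 2) = 0 ∧ U (s, -(1 / 2)) = 0 := by
  obtain ⟨I, hI, eI⟩ := exists_primitive hw
  obtain ⟨J, hJ, eJ, zJ⟩ := exists_primitive_vanishing hI (-(1 / 2))
  have ht := trace_isSmoothPeriodic hJ (1 / 2)
  -- A double primitive vanishing at -1/2, minus J(·, 1/2)(ξ + 1/2), vanishes at both ends and has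
  -- the same second derivative.
  have hm := sub_mem_profiles hJ (add_mem_profiles (mul_pow_mem_profiles ht 1)
    (const_mul_mem_profiles (1 / 2) (fst_mem_profiles ht)))
  have e1 : ∀ x, pd 1 (fun x : ℝ × ℝ => J x - (J (x.1, 1 / 2) * x.2 ^ 1 + 1 / 2 * J (x.1, 1 / 2))) x =
      I x - J (x.1, 1 / 2) := by
    intro x
    refine pd_snd_eq (differentiable_of_mem_profiles hm x) ?_
    rw [← eJ x]
    refine ((hasDerivAt_snd (differentiable_of_mem_profiles hJ x)).sub
      (((hasDerivAt_pow 1 x.2).const_mul (J (x.1, 1 / 2))).add_const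
        (1 / 2 * J (x.1, 1 / 2)))).congr_deriv ?_
    simp
  refine ⟨_, hm, fun x => ?_, fun s => ⟨?_, ?_⟩⟩
  · rw [funext e1, ← eI x]
    refine pd_snd_eq ((differentiable_of_mem_profiles
      (sub_mem_profiles hI (fst_mem_profiles ht))) x) ?_
    exact (hasDerivAt_snd (differentiable_of_mem_profiles hI x)).sub_const (J (x.1, 1 / 2))
  · ring
  · simp only [zJ]
    ring

/-- The flux problem: the stream function `Q` has constant values on the horizontal boundary. -/
lemma exists_stream_function (hν : IsSmoothPeriodic ν) (hpos : ∀ s, 0 < ν s) (hw : w ∈ profiles) :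
    ∃ Q ∈ profiles, ∃ q, IsSmoothPeriodic q ∧
      (∀ x, ν x.1 / 2 * pd 1 (pd 1 (pd 1 Q)) x = w x + deriv q x.1) ∧
      (∀ s, pd 1 Q (s, 1 / 2) = 0 ∧ pd 1 Q (s, -(1 / 2)) = 0) ∧
      ∀ s, pd 0 Q (s, 1 / 2) = 0 ∧ pd 0 Q (s, -(1 / 2)) = 0 := by
  obtain ⟨U, hU, eU, zU⟩ := exists_dirichlet_solution hw
  obtain ⟨V, hV, eV, zV⟩ := exists_primitive_vanishing hU (-(1 / 2))
  have ht := trace_isSmoothPeriodic hV (1 / 2)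
  -- The slope q' adds (ξ² - 1/4) q'/2 to the profile `U`, whose integral is -q'/12. The total flux
  -- (2/ν)(V(1/2) - q'/12) is constant in x₁ exactly when q' = 12 V(1/2) - c ν, and c is then chosen
  -- so that q is periodic.
  have hg := (IsSmoothPeriodic.const 12).mul ht
  obtain ⟨c, hc⟩ := exists_mean_zero hν.smooth.continuous hpos hg.smooth.continuous
  have hd := hg.sub ((IsSmoothPeriodic.const c).mul hν)
  obtain ⟨q, q_per, q_der⟩ := exists_periodic_primitive hd.smooth.continuous hd.periodic hc
  have q_deriv : deriv q = fun s => 12 * V (s, 1 / 2) - c * ν s := funext fun s => (q_der s).deriv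
  have hq : IsSmoothPeriodic q :=
    ⟨contDiff_infty_iff_deriv.2 ⟨fun s => (q_der s).differentiableAt, by
      rw [q_deriv]; exact hd.smooth⟩, q_per⟩
  have hq' := hq.deriv
  have hinv : IsSmoothPeriodic fun s => 2 / ν s :=
    ⟨contDiff_const.div hν.smooth fun s => (hpos s).ne', fun s => by simp only [hν.periodic s]⟩
  set d := deriv q with hd_def
  have hQ : (fun x : ℝ × ℝ => 2 / ν x.1 * (V x + (1 / 6 * (d x.1 * x.2 ^ 3)
      - (1 / 8 * (d x.1 * x.2 ^ 1) + 1 / 24 * d x.1)))) ∈ profiles :=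
    mul_mem_profiles hinv (add_mem_profiles hV (sub_mem_profiles
      (const_mul_mem_profiles _ (mul_pow_mem_profiles hq' 3))
      (add_mem_profiles (const_mul_mem_profiles _ (mul_pow_mem_profiles hq' 1))
        (const_mul_mem_profiles _ (fst_mem_profiles hq')))))
  have hQ1 : (fun x : ℝ × ℝ => 2 / ν x.1 * (U x + (1 / 2 * (d x.1 * x.2 ^ 2) - 1 / 8 * d x.1)))
      ∈ profiles :=
    mul_mem_profiles hinv (add_mem_profiles hU (sub_mem_profiles
      (const_mul_mem_profiles _ (mul_pow_mem_profiles hq' 2))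
      (const_mul_mem_profiles _ (fst_mem_profiles hq'))))
  have hQ2 : (fun x : ℝ × ℝ => 2 / ν x.1 * (pd 1 U x + d x.1 * x.2 ^ 1)) ∈ profiles :=
    mul_mem_profiles hinv (add_mem_profiles (pd_mem_profiles hU 1) (mul_pow_mem_profiles hq' 1))
  -- The cubic is the primitive of that parabola vanishing at -1/2, so `Q` is zero on the lower wall
  -- and c/6 on the upper one.
  set Q := fun x : ℝ × ℝ => 2 / ν x.1 * (V x + (1 / 6 * (d x.1 * x.2 ^ 3)
      - (1 / 8 * (d x.1 * x.2 ^ 1) + 1 / 24 * d x.1))) with hQdef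
  have e1 : pd 1 Q = fun x => 2 / ν x.1 * (U x + (1 / 2 * (d x.1 * x.2 ^ 2) - 1 / 8 * d x.1)) := by
    funext x
    refine pd_snd_eq (differentiable_of_mem_profiles hQ x) ?_
    rw [← eV x]
    refine ((((hasDerivAt_snd (differentiable_of_mem_profiles hV x)).add
      (((((hasDerivAt_pow 3 x.2).const_mul (d x.1)).const_mul (1 / 6))).sub
      ((((hasDerivAt_pow 1 x.2).const_mul (d x.1)).const_mul (1 / 8)).add_const
        (1 / 24 * d x.1)))).const_mul (2 / ν x.1))).congr_deriv ?_
    norm_num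
    left
    ring
  have e2 : pd 1 (pd 1 Q) = fun x => 2 / ν x.1 * (pd 1 U x + d x.1 * x.2 ^ 1) := by
    rw [e1]
    funext x
    refine pd_snd_eq (differentiable_of_mem_profiles hQ1 x) ?_
    refine ((((hasDerivAt_snd (differentiable_of_mem_profiles hU x)).add
      (((((hasDerivAt_pow 2 x.2).const_mul (d x.1)).const_mul (1 / 2))).sub_const
        (1 / 8 * d x.1))).const_mul (2 / ν x.1))).congr_deriv ?_
    norm_num
    left
    ring
  refine ⟨Q, hQ, q, hq, fun x => ?_, fun s => ⟨?_, ?_⟩, fun s => ⟨?_, ?_⟩⟩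
  · have e3 : pd 1 (pd 1 (pd 1 Q)) x = 2 / ν x.1 * (w x + d x.1) := by
      rw [e2]
      refine pd_snd_eq (differentiable_of_mem_profiles hQ2 x) ?_
      rw [← eU x]
      refine ((((hasDerivAt_snd (differentiable_of_mem_profiles (pd_mem_profiles hU 1) x)).add
        (((hasDerivAt_pow 1 x.2).const_mul (d x.1)))).const_mul (2 / ν x.1))).congr_deriv ?_
      simp
    rw [e3, ← hd_def]
    have := (hpos x.1).ne'
    field_simp
  · rw [e1]
    simp only [(zU s).1]
    ring
  · rw [e1]
    simp only [(zU s).2]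
    ring
  · refine pd_fst_eq (differentiable_of_mem_profiles hQ _) ?_
    have hconst : (fun s => Q (s, (s, (1 / 2 : ℝ)).2)) = fun _ => c / 6 := by
      funext s
      have := (hpos s).ne'
      simp only [hQdef, q_deriv]
      field_simp
      ring
    have := hasDerivAt_const (s, (1 / 2 : ℝ)).1 (c / 6)
    rwa [← hconst] at this
  · refine pd_fst_eq (differentiable_of_mem_profiles hQ _) ?_
    have hconst : (fun s => Q (s, (s, (-(1 / 2) : ℝ)).2)) = fun _ => 0 := by
      funext s
      simp only [hQdef, zV]
      ring
    have := hasDerivAt_const (s, (-(1 / 2) : ℝ)).1 (0 : ℝ)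
    rwa [← hconst] at this

/-! ### Recursive construction for smooth viscosity -/

/-- The equations of index `j`, with smooth coefficients. -/
structure SolvesAt (ν f₁ : ℝ → ℝ) (a : Coeffs) (j : ℕ) : Prop where
  mem_u₁ : a.u₁ j ∈ profiles
  mem_u₂ : a.u₂ j ∈ profiles
  mem_p : a.p j ∈ profiles
  smooth_q : IsSmoothPeriodic (a.q j)
  mean_p : ∀ s, ∫ ξ in (-(1 / 2) : ℝ)..(1 / 2), a.p j (s, ξ) = 0
  momentum₁ : ∀ x : ℝ × ℝ,
    -pd 0 (fun y => ν y.1 * pd 0 (back a.u₁ j 2) y) x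
      - ν x.1 / 2 * pd 1 (pd 1 (a.u₁ j)) x
      - ν x.1 / 2 * pd 1 (pd 0 (back a.u₂ j 2)) x
      + pd 0 (back a.p j 1) x + deriv (a.q j) x.1 = if j = 0 then f₁ x.1 else 0
  momentum₂ : ∀ x : ℝ × ℝ,
    1 / 2 * pd 0 (fun y => ν y.1 * (pd 1 (back a.u₁ j 1) y + pd 0 (back a.u₂ j 3) y)) x
      + ν x.1 * pd 1 (pd 1 (back a.u₂ j 1)) x - pd 1 (a.p j) x = 0
  incompressible : ∀ x : ℝ × ℝ, pd 0 (a.u₁ j) x + pd 1 (a.u₂ j) x = 0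
  bdry_u₁ : ∀ s, a.u₁ j (s, 1 / 2) = 0 ∧ a.u₁ j (s, -(1 / 2)) = 0
  bdry_u₂ : ∀ s, a.u₂ j (s, 1 / 2) = 0 ∧ a.u₂ j (s, -(1 / 2)) = 0

lemma back_update_of_lt (w : ℕ → ℝ × ℝ → ℝ) {n j : ℕ} (v : ℝ × ℝ → ℝ) (h : j < n) (m : ℕ) :
    back (Function.update w n v) j m = back w j m := by
  unfold back
  split_ifs
  · rw [Function.update_of_ne (by omega)]
  · rfl

lemma back_update_self (w : ℕ → ℝ × ℝ → ℝ) (n : ℕ) (v : ℝ × ℝ → ℝ) {m : ℕ} (hm : 1 ≤ m) :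
    back (Function.update w n v) n m = back w n m := by
  unfold back
  split_ifs
  · rw [Function.update_of_ne (by omega)]
  · rfl

lemma back_mem_profiles {w : ℕ → ℝ × ℝ → ℝ} {n m : ℕ} (hw : ∀ j < n, w j ∈ profiles) (hm : 1 ≤ m) :
    back w n m ∈ profiles := by
  unfold back
  split_ifs
  · exact hw _ (by omega)
  · exact profiles.zero_mem

/-- Index n sees earlier coefficients only as data: the first momentum equation is the flux problem
for `Q`, the second gives `p` by a mean-zero primitive. With velocity (∂₂Q, -∂₁Q), incompressibility
is symmetry of second derivatives, and u₂ vanishes on the walls because `Q` is constant there. -/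
lemma exists_solvesAt (hν : IsSmoothPeriodic ν) (hpos : ∀ s, 0 < ν s) (hf : IsSmoothPeriodic f₁)
    (n : ℕ) : ∃ a : Coeffs, ∀ j < n, SolvesAt ν f₁ a j := by
  induction n with
  | zero => exact ⟨⟨0, 0, 0, 0⟩, fun j hj => absurd hj (Nat.not_lt_zero j)⟩
  | succ n ih =>
    obtain ⟨a, ha⟩ := ih
    have m₁ : ∀ m, 1 ≤ m → back a.u₁ n m ∈ profiles := fun m =>
      back_mem_profiles fun j hj => (ha j hj).mem_u₁
    have m₂ : ∀ m, 1 ≤ m → back a.u₂ n m ∈ profiles := fun m =>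
      back_mem_profiles fun j hj => (ha j hj).mem_u₂
    have m₃ : back a.p n 1 ∈ profiles := back_mem_profiles (fun j hj => (ha j hj).mem_p) le_rfl
    have hforce : IsSmoothPeriodic fun s => if n = 0 then f₁ s else 0 := by
      split_ifs
      · exact hf
      · exact IsSmoothPeriodic.const 0
    have hF := sub_mem_profiles (add_mem_profiles (sub_mem_profiles
      (neg_mem_profiles (pd_mem_profiles (mul_mem_profiles hν
        (pd_mem_profiles (m₁ 2 (by norm_num)) 0)) 0))
      (const_mul_mem_profiles (1 / 2) (mul_mem_profiles hν
        (pd_mem_profiles (pd_mem_profiles (m₂ 2 (by norm_num)) 0) 1))))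
      (pd_mem_profiles m₃ 0)) (fst_mem_profiles hforce)
    obtain ⟨Q, hQ, q, hq, eQ, z₁, z₀⟩ := exists_stream_function hν hpos hF
    have hH := add_mem_profiles (const_mul_mem_profiles (1 / 2) (pd_mem_profiles (mul_mem_profiles hν
      (add_mem_profiles (pd_mem_profiles (m₁ 1 le_rfl) 1)
        (pd_mem_profiles (m₂ 3 (by norm_num)) 0))) 0))
      (mul_mem_profiles hν (pd_mem_profiles (pd_mem_profiles (m₂ 1 le_rfl) 1) 1))
    obtain ⟨p, hp, ep, mp⟩ := exists_primitive_mean_zero hH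
    refine ⟨⟨Function.update a.u₁ n (pd 1 Q), Function.update a.u₂ n (fun x => -pd 0 Q x),
      Function.update a.p n p, Function.update a.q n q⟩, fun j hj => ?_⟩
    rcases Nat.lt_succ_iff_lt_or_eq.1 hj with hj | rfl
    · have h := ha j hj
      constructor <;> simp only [back_update_of_lt _ _ hj, Function.update_of_ne hj.ne]
      exacts [h.mem_u₁, h.mem_u₂, h.mem_p, h.smooth_q, h.mean_p, h.momentum₁, h.momentum₂,
        h.incompressible, h.bdry_u₁, h.bdry_u₂]
    · constructor <;> simp only [back_update_self _ _ _ le_rfl,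
        back_update_self _ _ _ (show 1 ≤ 2 by norm_num),
        back_update_self _ _ _ (show 1 ≤ 3 by norm_num), Function.update_self]
      · exact pd_mem_profiles hQ 1
      · exact neg_mem_profiles (pd_mem_profiles hQ 0)
      · exact hp
      · exact hq
      · exact mp
      · intro x
        have := eQ x
        linarith
      · intro x
        rw [ep x]
        ring
      · intro x
        have hQ2 : ContDiff ℝ 2 Q :=
          (contDiff_of_mem_profiles hQ).of_le (WithTop.coe_le_coe.2 (le_top : (2 : ℕ∞) ≤ ⊤))
        rw [pd_neg, pd_comm (i := 0) (j := 1) hQ2, add_neg_cancel]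
      · exact z₁
      · intro s
        simp only [(z₀ s).1, (z₀ s).2, neg_zero, and_self]

/-- Existence of the ansatz for a smooth viscosity. -/
theorem exists_isAnsatz_of_smooth (hν : IsSmoothPeriodic ν) (hpos : ∀ s, 0 < ν s)
    (hf : IsSmoothPeriodic f₁) (k : ℕ) : ∃ a : Coeffs, IsAnsatz ν f₁ k a := by
  obtain ⟨a, h⟩ := exists_solvesAt hν hpos hf (k + 1)
  replace h : ∀ j ≤ k, SolvesAt ν f₁ a j := fun j hj => h j (by omega)
  have two : ∀ {w : ℝ × ℝ → ℝ}, w ∈ profiles → ContDiff ℝ 2 w := fun hw =>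
    (contDiff_of_mem_profiles hw).of_le (WithTop.coe_le_coe.2 (le_top : (2 : ℕ∞) ≤ ⊤))
  exact ⟨a,
    { smooth_u₁ := fun j hj => two (h j hj).mem_u₁
      smooth_u₂ := fun j hj => two (h j hj).mem_u₂
      smooth_p := fun j hj => (two (h j hj).mem_p).of_le (by norm_num)
      smooth_q := fun j hj => (h j hj).smooth_q.smooth.of_le (by exact_mod_cast le_top)
      per_u₁ := fun j hj s ξ _ => periodic_of_mem_profiles (h j hj).mem_u₁ s ξ
      per_u₂ := fun j hj s ξ _ => periodic_of_mem_profiles (h j hj).mem_u₂ s ξ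
      per_p := fun j hj s ξ _ => periodic_of_mem_profiles (h j hj).mem_p s ξ
      per_q := fun j hj => (h j hj).smooth_q.periodic
      mean_p := fun j hj => (h j hj).mean_p
      momentum₁ := fun j hj x _ => (h j hj).momentum₁ x
      momentum₂ := fun j hj x _ => (h j hj).momentum₂ x
      incompressible := fun j hj x _ => (h j hj).incompressible x
      bdry_u₁ := fun j hj => (h j hj).bdry_u₁
      bdry_u₂ := fun j hj => (h j hj).bdry_u₂ }⟩

/-! ### Explicit coefficients for orders zero and one -/

lemma pd_snd_poly (c : ℝ → ℝ) (hc : Differentiable ℝ c) (r : ℝ) (x : ℝ × ℝ) :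
    pd 1 (fun y : ℝ × ℝ => c y.1 * (y.2 ^ 2 - r)) x = c x.1 * (2 * x.2) := by
  refine pd_snd_eq (by fun_prop) ?_
  exact (((hasDerivAt_pow 2 x.2).sub_const r).const_mul (c x.1)).congr_deriv (by norm_num)

/-- Existence of the ansatz of order at most one. -/
theorem exists_isAnsatz_of_le_one (hν : ContDiff ℝ 2 ν) (hν_per : Function.Periodic ν 1)
    (hpos : ∀ s, 0 < ν s) (hf : Continuous f₁) (hf_per : Function.Periodic f₁ 1) {k : ℕ}
    (hk : k ≤ 1) : ∃ a : Coeffs, IsAnsatz ν f₁ k a := by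
  -- The parabola -c(ξ² - 1/4) contributes c ν to the first equation, so q' must equal f₁ - c ν; its
  -- zero mean determines c.
  obtain ⟨c, hc⟩ := exists_mean_zero hν.continuous hpos hf
  have hgc : Continuous fun s => f₁ s - c * ν s := hf.sub (continuous_const.mul hν.continuous)
  obtain ⟨q, q_per, q_der⟩ := exists_periodic_primitive hgc
    (fun s => by simp only [hν_per s, hf_per s]) hc
  have q_deriv : deriv q = fun s => f₁ s - c * ν s := funext fun s => (q_der s).deriv
  have hq : ContDiff ℝ 1 q :=
    contDiff_one_iff_deriv.2 ⟨fun s => (q_der s).differentiableAt, by rw [q_deriv]; exact hgc⟩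
  have hν' : ContDiff ℝ 1 (deriv ν) := by
    have h2 : ContDiff ℝ (1 + 1) ν := by norm_num; exact hν
    exact (contDiff_succ_iff_deriv.1 h2).2.2
  have hν'_per : Function.Periodic (deriv ν) 1 := periodic_deriv hν_per
  let u : ℝ × ℝ → ℝ := fun x => -c * (x.2 ^ 2 - 1 / 4)
  -- The pressure of index one, solving ∂₂p = ½ ν' ∂₂u; 1/12 is the mean of ξ² over the section. It
  -- is C¹ because ν is C².
  let p : ℝ × ℝ → ℝ := fun x => -(c / 2) * deriv ν x.1 * (x.2 ^ 2 - 1 / 12)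
  have hu : ContDiff ℝ 2 u := by fun_prop
  have hp : ContDiff ℝ 1 p := (contDiff_const.mul (hν'.comp contDiff_fst)).mul
    ((contDiff_snd.pow 2).sub contDiff_const)
  have u1 : pd 1 u = fun x => -c * (2 * x.2) :=
    funext fun x => pd_snd_poly (fun _ => -c) (differentiable_const _) _ x
  have u11 : pd 1 (pd 1 u) = fun x => -c * 2 := by
    rw [u1]
    funext x
    refine pd_snd_eq (by fun_prop) ?_
    exact (((hasDerivAt_id x.2).const_mul 2).const_mul (-c)).congr_deriv (by norm_num)
  have u0 : pd 0 u = 0 := by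
    funext x
    exact pd_fst_eq ((hu.differentiable (by norm_num)) x) (hasDerivAt_const x.1 (u x))
  have p1 : ∀ x, pd 1 p x = -(c / 2) * deriv ν x.1 * (2 * x.2) :=
    pd_snd_poly (fun s => -(c / 2) * deriv ν s) ((hν'.differentiable one_ne_zero).const_mul _) _
  have νu : ∀ x : ℝ × ℝ, pd 0 (fun y => ν y.1 * (pd 1 u y + pd 0 (0 : ℝ × ℝ → ℝ) y)) x =
      deriv ν x.1 * (-c * (2 * x.2)) := by
    intro x
    simp only [pd_zero, u1, Pi.zero_apply, add_zero]
    have hνd : Differentiable ℝ ν := hν.differentiable (by norm_num)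
    refine pd_fst_eq (by fun_prop) ?_
    exact ((hνd x.1).hasDerivAt).mul_const (-c * (2 * x.2))
  have mean : ∀ s, ∫ ξ in (-(1 / 2) : ℝ)..(1 / 2), p (s, ξ) = 0 := by
    intro s
    simp only [p]
    rw [intervalIntegral.integral_const_mul, intervalIntegral.integral_sub
      ((continuous_pow 2).intervalIntegrable _ _) (by simp), integral_pow,
      intervalIntegral.integral_const]
    norm_num
  -- The leading profile is independent of x₁, so u₂ may be zero; at index one the first equation
  -- has zero data, and only `p` is nonzero.
  refine ⟨⟨fun j => if j = 0 then u else 0, 0, fun j => if j = 1 then p else 0,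
    fun j => if j = 0 then q else 0⟩, ?_⟩
  have z2 : ∀ {r : WithTop ℕ∞}, ContDiff ℝ r (0 : ℝ × ℝ → ℝ) := contDiff_const
  have cases : ∀ j ≤ k, j = 0 ∨ j = 1 := fun j hj => by omega
  constructor
  · intro j hj
    rcases cases j hj with rfl | rfl <;> simp [hu, z2]
  · intro j hj
    exact z2
  · intro j hj
    rcases cases j hj with rfl | rfl <;> simp [hp, z2]
  · intro j hj
    rcases cases j hj with rfl | rfl
    · simpa using hq
    · exact (contDiff_const : ContDiff ℝ 1 fun _ : ℝ => (0 : ℝ))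
  · intro j hj s ξ _
    rcases cases j hj with rfl | rfl <;> simp [u]
  · intro j hj s ξ _
    rfl
  · intro j hj s ξ _
    rcases cases j hj with rfl | rfl <;> simp [p, hν'_per s]
  · intro j hj
    rcases cases j hj with rfl | rfl
    · simpa using q_per
    · intro s
      simp
  · intro j hj s
    rcases cases j hj with rfl | rfl
    · simp
    · simpa using mean s
  · intro j hj x _
    rcases cases j hj with rfl | rfl
    · simp [back, pd_zero, pd_const, u11, q_deriv]
      ring
    · simp [back, pd_zero, pd_const]
  · intro j hj x _
    rcases cases j hj with rfl | rfl
    · simp [back, pd_zero, pd_const]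
    · have := νu x
      simp only [back, le_refl, if_true, Nat.sub_self, show ¬ (3 ≤ 1) by norm_num, if_false,
        Pi.zero_apply, this, p1]
      simp only [pd_zero, Pi.zero_apply]
      ring
  · intro j hj x _
    rcases cases j hj with rfl | rfl <;> simp [pd_zero, u0]
  · intro j hj s
    rcases cases j hj with rfl | rfl
    · simp only [if_true, u]
      norm_num
    · simp
  · intro j hj s
    simp

end Existence

end ThinStokes

end

theorem mainTheorem3 (ν f₁ : ℝ → ℝ) (κ : ℝ) (hκ : 0 < κ)
    (hν : ContDiff ℝ 2 ν) (hν_per : Function.Periodic ν 1)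
    (hν_pos : ∀ s ∈ Set.Ioo (0 : ℝ) 1, κ ≤ ν s)
    (hf : ContDiff ℝ ∞ f₁) (hf_per : Function.Periodic f₁ 1) (k : ℕ) :
    ((ContDiff ℝ ∞ ν ∨ k ≤ 1) → ∃ a : ThinStokes.Coeffs, ThinStokes.IsAnsatz ν f₁ k a) ∧
    ∀ a : ThinStokes.Coeffs, ThinStokes.IsAnsatz ν f₁ k a →
      ∃ C : ℝ, ∀ ε : ℝ, 0 < ε → ε ≤ 1 →
        ∀ u G, ThinStokes.IsWeakSolution ν f₁ ε u G →
          ThinStokes.h1Norm (ThinStokes.strip ε) (fun i => a.velocity k ε i - u i)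
              ≤ ENNReal.ofReal (C * ε ^ ((k : ℝ) + 5 / 2)) ∧
          ∀ p : 𝓓'(ThinStokes.strip ε, ℝ), ThinStokes.IsPressure ν f₁ ε G p →
            ThinStokes.hMinusOneNorm (ThinStokes.strip ε) (fun i =>
                ThinStokes.grad
                  (ThinStokes.funDistribution (ThinStokes.strip ε) (a.pressure k ε)) i
                  - ThinStokes.grad p i)
              ≤ ENNReal.ofReal (C * ε ^ ((k : ℝ) + 5 / 2)) := by
  have hpos : ∀ s, 0 < ν s := fun s =>
    hκ.trans_le (ThinStokes.le_of_periodic hν.continuous hν_per hν_pos s)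
  refine ⟨?_, fun a ha => ha.exists_error_bound hκ (hν.of_le (by norm_num)) hν_per hν_pos
    hf.continuous⟩
  rintro (h | h)
  · exact ThinStokes.exists_isAnsatz_of_smooth ⟨h, hν_per⟩ hpos ⟨hf, hf_per⟩ k
  · exact ThinStokes.exists_isAnsatz_of_le_one hν hν_per hpos hf.continuous hf_per h
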